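/- **Setting.** A bilevel problem $(P)$ is a family of instances indexed by words $i\in\{0,1\}^*$. An instance consists of domains $\mathcal X_i\subseteq\mathbb R^{n_x}$, $\mathcal Y_i\subseteq\mathbb R^{n_y}$, objectives $F,f$ and constraint functions $G_k$ ($1\le k\le m_u$), $g_j$ ($1\le j\le m_l$), all real-valued functions of $(x,y)$; together with a tolerance $\delta=\delta_i$. For $x\in\mathcal X$ the lower-level problem $\mathcal L(x)$ is $\min_{y\in\mathcal Y}\{f(x,y): g_j(x,y)\le 0\ \forall j\}$. The canonical problem is $$\text{(BiP)}\quad \min_{x,v}F(x,v)\ \text{ s.t. } x\in\mathcal X,\ G_k(x,v)\le 0\ \forall k,\ v\in\arg\min \mathcal L(x),$$ and (NORBiP) has the further constraints $G_k(x,z)\le 0$ for all $k$ and all $z\in\mathcal Z(x;\delta)=\{y\in\mathcal Y: f(x,y)\le f(x,v)+\delta,\ g_j(x,y)\le0\ \forall j\}$. An optimization problem is said to be in a complexity class if the class contains the problem of deciding, for an instance and a rational bound $\Gamma$, whether some feasible solution has objective value at most $\Gamma$. Rationals are given as binary fractions; an instance of the lower-level problem is a pair $(i,x)$ with $x\in\mathcal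 X_i$ rational. The classes are $\Sigma_1^P=\mathrm{NP}$ and $\Sigma_2^P$ = problems solvable in nondeterministic polynomial time with an oracle for a problem in NP. **The class $\mathrm{NP}^*[\mathcal H]$.** For each instance let $\mathcal H$ be a set of real-valued functions on $\mathbb R^{n_y}$. The lower-level problem is in $\mathrm{NP}^*[\mathcal H]$ if it is in NP and, for objectives $h\in\mathcal H$, the problem $$\min_{y,u}\ h(y)\ \text{ s.t. } y\in\mathcal Y,\ g_j(x,y)\le 0\ \forall j,\ f(x,y)\le u,\ a^{\top}y+bu\le c,$$ that is, its epigraph form with one additional linear constraint and a new objective, is also in NP. This is meant uniformly: for every family of functions $h_{i,x,w}\in\mathcal H$ (with $x\in\mathcal X_i$ and $w$ a word) whose domain of parameters $(i,x,w)$ is decidable in polynomial time and whose values at rational points of $\mathcal Y$ are rational and computable in polynomial time, the problem with objective $h_{i,x,w}$ and input $(i,x,w,a,b,c)$ is in NP. **Standing assumptions.** (a) $m_u$ (in unary) and $\delta$ (which is rational) are computable in polynomial time from $i$; at rational points of $\mathcal X\times\mathcal Y$ the values $F,f,G_k$ are rational and computable in polynomial time; for rational points, $x\in\mathcal X$ and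 lower-level feasibility of $y$ for given $x\in\mathcal X$ are decidable in polynomial time. (b) There is a polynomial $p$ such that for all rational $x\in\mathcal X$ and rational $v$ feasible for $\mathcal L(x)$, with $N$ the encoding length of $(i,x,v)$: if $v$ is not optimal for $\mathcal L(x)$, then some feasible $y$ has $f(x,y)\le f(x,v)-2^{-p(N)}$; and if $v$ is optimal and $G_k(x,z)>0$ for some $z\in\mathcal Z(x;\delta)$, then $G_k(x,z)\ge 2^{-p(N)}$ for some $z\in\mathcal Z(x;\delta)$. We say that (NORBiP), respectively (BiP), has polynomial-size solutions if, whenever it has a feasible $(x,v)$ with $F(x,v)\le\Gamma$, it has such an $(x,v)$ that is rational with encoding length polynomial in that of $(i,\Gamma)$. **Theorem 1.** Assume (a) and (b), and suppose there exists $\mathcal H$ such that the lower-level problem is in $\mathrm{NP}^*[\mathcal H]$ and $-G_k(x,\cdot)\in\mathcal H$ for all $k\in\{1,\dots,m_u\}$ and all $x\in\mathcal X$. If (NORBiP) has polynomial-size solutions, then the near-optimal robust problem (NORBiP) is in $\Sigma_2^P$; likewise, if (BiP) has polynomial-size solutions, the canonical problem (BiP) is in $\Sigma_2^P$. -/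

import Mathlib

open Computability

/-! ## A machine model with oracle and step count -/

/-- Bit strings. -/
abbrev Word := List Bool

/-- Programs of a multi-stack machine with structured control.  Every register holds a word and is
used as a stack of bits.  (Registers are numbered by `ℕ`; a program uses finitely many of them.)  Such a program and a
multi-tape Turing machine simulate each other with at most polynomial overhead: the work tape to
the left and to the right of a head is a pair of stacks, and the finite control is one loop. -/
inductive Prog
  | skip : Prog
  /-- Push the bit `b` onto register `r`. -/
  | push (r : ℕ) (b : Bool) : Prog
  /-- Remove the top bit of register `r`, if there is one. -/
  | pop (r : ℕ) : Prog
  /-- Ask the oracle about the word in register `r` and push the answer onto register `s`. -/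
  | query (r s : ℕ) : Prog
  | seq (p q : Prog) : Prog
  /-- Branch on register `r`: empty, top bit `false`, top bit `true`. -/
  | branch (r : ℕ) (pEmpty pFalse pTrue : Prog) : Prog
  /-- Repeat `p` as long as register `r` is non-empty. -/
  | loop (r : ℕ) (p : Prog) : Prog

/-- The contents of the registers. -/
abbrev Store := ℕ → Word

/-- `Run O p σ σ' t`: with oracle `O`, the program `p` started in `σ` halts in `σ'` after exactly
`t` steps.  Every instruction, every test and every oracle call costs one step. -/
inductive Run (O : Language Bool) : Prog → Store → Store → ℕ → Prop
  | skip (σ : Store) : Run O .skip σ σ 1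
  | push (r : ℕ) (b : Bool) (σ : Store) :
      Run O (.push r b) σ (Function.update σ r (b :: σ r)) 1
  | pop (r : ℕ) (σ : Store) :
      Run O (.pop r) σ (Function.update σ r (σ r).tail) 1
  | query_yes (r s : ℕ) (σ : Store) (h : σ r ∈ O) :
      Run O (.query r s) σ (Function.update σ s (true :: σ s)) 1
  | query_no (r s : ℕ) (σ : Store) (h : σ r ∉ O) :
      Run O (.query r s) σ (Function.update σ s (false :: σ s)) 1
  | seq {p q : Prog} {σ σ' σ'' : Store} {t t' : ℕ}
      (hp : Run O p σ σ' t) (hq : Run O q σ' σ'' t') : Run O (.seq p q) σ σ'' (t + t')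
  | branch_empty {r : ℕ} {p₁ p₂ p₃ : Prog} {σ σ' : Store} {t : ℕ}
      (h : σ r = []) (hp : Run O p₁ σ σ' t) : Run O (.branch r p₁ p₂ p₃) σ σ' (t + 1)
  | branch_false {r : ℕ} {p₁ p₂ p₃ : Prog} {σ σ' : Store} {t : ℕ} {w : Word}
      (h : σ r = false :: w) (hp : Run O p₂ σ σ' t) : Run O (.branch r p₁ p₂ p₃) σ σ' (t + 1)
  | branch_true {r : ℕ} {p₁ p₂ p₃ : Prog} {σ σ' : Store} {t : ℕ} {w : Word}
      (h : σ r = true :: w) (hp : Run O p₃ σ σ' t) : Run O (.branch r p₁ p₂ p₃) σ σ' (t + 1)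
  | loop_done {r : ℕ} {p : Prog} {σ : Store} (h : σ r = []) : Run O (.loop r p) σ σ 1
  | loop_step {r : ℕ} {p : Prog} {σ σ' σ'' : Store} {t t' : ℕ} (h : σ r ≠ [])
      (hp : Run O p σ σ' t) (hl : Run O (.loop r p) σ' σ'' t') :
      Run O (.loop r p) σ σ'' (t + t' + 1)

/-- The initial store: the input in register `0`, all other registers empty. -/
def initStore (s : Word) : Store := Function.update (fun _ => []) 0 s

/-- With oracle `O`, the function `φ` is computable in polynomial time (output in register `0`). -/
def PolyTimeRel (O : Language Bool) (φ : Word → Word) : Prop :=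
  ∃ (p : Prog) (T : Polynomial ℕ), ∀ s : Word, ∃ (σ : Store) (t : ℕ),
    Run O p (initStore s) σ t ∧ t ≤ T.eval s.length ∧ σ 0 = φ s

/-- Polynomial-time computable functions (the oracle is the empty language). -/
def PolyTime (φ : Word → Word) : Prop := PolyTimeRel 0 φ

/-- The class `P^O` of languages decidable in polynomial time with oracle `O`. -/
def PRel (O : Language Bool) : Set (Language Bool) :=
  {L | ∃ (p : Prog) (T : Polynomial ℕ), ∀ s : Word, ∃ (σ : Store) (t : ℕ),
    Run O p (initStore s) σ t ∧ t ≤ T.eval s.length ∧ (s ∈ L ↔ σ 0 = [true])}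

/-! ## Encodings -/

/-- Self-delimiting form of a word: each bit `b` becomes `1b`, and `0` marks the end. -/
def delimit (w : Word) : Word := w.flatMap (fun b => [true, b]) ++ [false]

/-- The encoding of a finite sequence of words by one word. -/
def encTuple (ws : List Word) : Word := ws.flatMap delimit

/-- Sign bit followed by the binary expansion of the absolute value. -/
def encInt (z : ℤ) : Word := decide (z < 0) :: encodeNat z.natAbs

/-- Rational numbers, written as (not necessarily reduced) fractions. -/
abbrev Frac := ℤ × ℕ+

/-- The value of a fraction. -/
noncomputable def Frac.val (q : Frac) : ℝ := (q.1 : ℝ) / ((q.2 : ℕ) : ℝ)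

def encFrac (q : Frac) : Word := encTuple [encInt q.1, encodeNat (q.2 : ℕ)]

/-- Rational vectors, each coordinate written as a fraction. -/
abbrev FracVec (n : ℕ) := Fin n → Frac

noncomputable def FracVec.val {n : ℕ} (x : FracVec n) : Fin n → ℝ := fun j => Frac.val (x j)

def encVec {n : ℕ} (x : FracVec n) : Word := encTuple (List.ofFn fun j => encFrac (x j))

/-! ## The polynomial hierarchy -/

/-- The class `NP^O`: yes-instances have certificates of polynomial length that can be verified in
polynomial time with oracle `O`. -/
def NPRel (O : Language Bool) : Set (Language Bool) :=
  {L | ∃ V ∈ PRel O, ∃ p : Polynomial ℕ, ∀ s : Word,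
    s ∈ L ↔ ∃ c : Word, c.length ≤ p.eval s.length ∧ encTuple [s, c] ∈ V}

/-- The classes of the polynomial hierarchy: `P`, `NP`, and then nondeterministic polynomial time
with an oracle for a problem of the previous class. -/
def SigmaP : ℕ → Set (Language Bool)
  | 0 => PRel 0
  | 1 => NPRel 0
  | s + 2 => {L | ∃ A ∈ SigmaP (s + 1), L ∈ NPRel A}

/-! ## Bilevel problems -/

/-- Some element of `S` has objective value at least as good as the bound `γ` (minimization). -/
def AttainsBound {α : Type*} (S : Set α) (obj : α → ℝ) (γ : ℝ) : Prop := ∃ a ∈ S, obj a ≤ γ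

/-- A bilevel problem, as a family of instances indexed by their encodings `i : Word` (a word that
encodes no instance can be given an empty upper-level domain). -/
structure BilevelProblem where
  /-- number of upper-level variables -/
  nx : Word → ℕ
  /-- number of lower-level variables -/
  ny : Word → ℕ
  /-- number of upper-level constraints -/
  mu : Word → ℕ
  /-- number of lower-level constraints -/
  ml : Word → ℕ
  /-- domain of the upper-level variables -/
  X : ∀ i, Set (Fin (nx i) → ℝ)
  /-- domain of the lower-level variables -/
  Y : ∀ i, Set (Fin (ny i) → ℝ)
  /-- upper-level objective -/
  F : ∀ i, (Fin (nx i) → ℝ) → (Fin (ny i) → ℝ) → ℝ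
  /-- upper-level constraints `G k x y ≤ 0` -/
  G : ∀ i, Fin (mu i) → (Fin (nx i) → ℝ) → (Fin (ny i) → ℝ) → ℝ
  /-- lower-level objective -/
  f : ∀ i, (Fin (nx i) → ℝ) → (Fin (ny i) → ℝ) → ℝ
  /-- lower-level constraints `g j x y ≤ 0` -/
  g : ∀ i, Fin (ml i) → (Fin (nx i) → ℝ) → (Fin (ny i) → ℝ) → ℝ

namespace BilevelProblem

variable (P : BilevelProblem)

/-- Feasible set of the lower-level problem with parameter `x`. -/
def lowerFeasible (i : Word) (x : Fin (P.nx i) → ℝ) : Set (Fin (P.ny i) → ℝ) :=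
  {y | y ∈ P.Y i ∧ ∀ j, P.g i j x y ≤ 0}

/-- Optimal solutions of the lower-level problem with parameter `x`. -/
def lowerOptimal (i : Word) (x : Fin (P.nx i) → ℝ) : Set (Fin (P.ny i) → ℝ) :=
  {v | v ∈ P.lowerFeasible i x ∧ ∀ y ∈ P.lowerFeasible i x, P.f i x v ≤ P.f i x y}

/-- The near-optimal set `Z(x; d)`, where `v` is the canonical lower-level decision. -/
def nearOptimal (d : ℝ) (i : Word) (x : Fin (P.nx i) → ℝ) (v : Fin (P.ny i) → ℝ) :
    Set (Fin (P.ny i) → ℝ) :=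
  {z | z ∈ P.lowerFeasible i x ∧ P.f i x z ≤ P.f i x v + d}

/-- Feasible set of the canonical (optimistic) bilevel problem. -/
def canonicalFeasible (i : Word) : Set ((Fin (P.nx i) → ℝ) × (Fin (P.ny i) → ℝ)) :=
  {p | p.1 ∈ P.X i ∧ (∀ k, P.G i k p.1 p.2 ≤ 0) ∧ p.2 ∈ P.lowerOptimal i p.1}

/-- Feasible set of the near-optimal robust bilevel problem with tolerance `δ`. -/
def robustFeasible (δ : Word → ℝ) (i : Word) :
    Set ((Fin (P.nx i) → ℝ) × (Fin (P.ny i) → ℝ)) :=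
  {p | p ∈ P.canonicalFeasible i ∧
    ∀ k, ∀ z ∈ P.nearOptimal (δ i) i p.1 p.2, P.G i k p.1 z ≤ 0}

/-- The decision problem of minimizing the upper-level objective over the sets `S i`. -/
def upperDecision (S : ∀ i, Set ((Fin (P.nx i) → ℝ) × (Fin (P.ny i) → ℝ))) : Language Bool :=
  {s | ∃ (i : Word) (γ : Frac), s = encTuple [i, encFrac γ] ∧
    AttainsBound (S i) (fun p => P.F i p.1 p.2) γ.val}

/-- The decision problem of the lower-level problem; an instance consists of an instance of the
bilevel problem and an upper-level decision. -/
def lowerDecision : Language Bool :=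
  {s | ∃ (i : Word) (x : FracVec (P.nx i)) (γ : Frac),
    s = encTuple [i, encVec x, encFrac γ] ∧ x.val ∈ P.X i ∧
    AttainsBound (P.lowerFeasible i x.val) (P.f i x.val) γ.val}

/-- Feasible set of the epigraph form `min u` s.t. `f x y ≤ u`, `y` feasible, of the lower-level
problem, with the additional linear constraint `a ⬝ y + b * u ≤ c`. -/
def epigraphWith (i : Word) (x : Fin (P.nx i) → ℝ) (a : Fin (P.ny i) → ℝ) (b c : ℝ) :
    Set ((Fin (P.ny i) → ℝ) × ℝ) :=
  {q | q.1 ∈ P.lowerFeasible i x ∧ P.f i x q.1 ≤ q.2 ∧ (∑ j, a j * q.1 j) + b * q.2 ≤ c}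

/-- A polynomial-time presented family of objective functions for the lower-level problem: a
function on the space of lower-level variables for each instance `i`, upper-level decision `x` and
parameter `w` in the domain of the family. -/
structure ObjectiveFamily where
  dom : ∀ i, (Fin (P.nx i) → ℝ) → Word → Prop
  fn : ∀ i, (Fin (P.nx i) → ℝ) → Word → (Fin (P.ny i) → ℝ) → ℝ
  dom_subset : ∀ i x w, dom i x w → x ∈ P.X i
  dom_decidable : ({s | ∃ (i : Word) (x : FracVec (P.nx i)) (w : Word),
    s = encTuple [i, encVec x, w] ∧ dom i x.val w} : Language Bool) ∈ SigmaP 0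
  fn_computable : ∃ φ : Word → Word, PolyTime φ ∧
    ∀ (i : Word) (x : FracVec (P.nx i)) (w : Word) (y : FracVec (P.ny i)),
      dom i x.val w → y.val ∈ P.Y i →
      ∃ r : Frac, φ (encTuple [i, encVec x, w, encVec y]) = encFrac r ∧
        r.val = fn i x.val w y.val

/-- The decision problem of the lower-level problem with an additional linear constraint and the
objective function replaced by a member of the family `h`. -/
def starDecision (h : P.ObjectiveFamily) : Language Bool :=
  {s | ∃ (i : Word) (x : FracVec (P.nx i)) (w : Word) (a : FracVec (P.ny i)) (b c γ : Frac),
    s = encTuple [i, encVec x, w, encVec a, encFrac b, encFrac c, encFrac γ] ∧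
    h.dom i x.val w ∧
    AttainsBound (P.epigraphWith i x.val a.val b.val c.val) (fun q => h.fn i x.val w q.1) γ.val}

/-- The lower-level problem is in `C*[H]`: it is in the class `C`, and it remains in `C` with an
additional linear constraint and with objective functions from `H`. -/
def LowerInStar (C : Set (Language Bool)) (H : ∀ i, Set ((Fin (P.ny i) → ℝ) → ℝ)) : Prop :=
  P.lowerDecision ∈ C ∧
  ∀ h : P.ObjectiveFamily, (∀ i x w, h.dom i x w → h.fn i x w ∈ H i) → P.starDecision h ∈ C

/-- A function of the upper- and lower-level variables is computable in polynomial time: at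
rational points of the domains its value is a rational number, computed from the encodings. -/
def Computable₂ (φ : ∀ i, (Fin (P.nx i) → ℝ) → (Fin (P.ny i) → ℝ) → ℝ) : Prop :=
  ∃ ψ : Word → Word, PolyTime ψ ∧
    ∀ (i : Word) (x : FracVec (P.nx i)) (y : FracVec (P.ny i)), x.val ∈ P.X i → y.val ∈ P.Y i →
      ∃ r : Frac, ψ (encTuple [i, encVec x, encVec y]) = encFrac r ∧ r.val = φ i x.val y.val

/-- The data of the bilevel problem and the tolerance are accessible in polynomial time: solutions
can be evaluated, and membership in the upper-level domain and lower-level feasibility checked. -/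
structure PolyPresented (δ : Word → ℝ) : Prop where
  mu_computable : PolyTime fun i => unaryEncodeNat (P.mu i)
  tol_computable : ∃ φ : Word → Word, PolyTime φ ∧
    ∀ i, ∃ r : Frac, φ i = encFrac r ∧ r.val = δ i
  F_computable : P.Computable₂ P.F
  f_computable : P.Computable₂ P.f
  G_computable : ∃ φ : Word → Word, PolyTime φ ∧
    ∀ (i : Word) (k : Fin (P.mu i)) (x : FracVec (P.nx i)) (y : FracVec (P.ny i)),
      x.val ∈ P.X i → y.val ∈ P.Y i →
      ∃ r : Frac, φ (encTuple [i, unaryEncodeNat k, encVec x, encVec y]) = encFrac r ∧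
        r.val = P.G i k x.val y.val
  X_decidable : ({s | ∃ (i : Word) (x : FracVec (P.nx i)),
    s = encTuple [i, encVec x] ∧ x.val ∈ P.X i} : Language Bool) ∈ SigmaP 0
  lower_decidable : ({s | ∃ (i : Word) (x : FracVec (P.nx i)) (y : FracVec (P.ny i)),
    s = encTuple [i, encVec x, encVec y] ∧ x.val ∈ P.X i ∧ y.val ∈ P.lowerFeasible i x.val} :
      Language Bool) ∈ SigmaP 0

/-- Non-optimality of a lower-level decision is visible at polynomial precision.  (This holds when
optimal values are rationals of polynomial length, as for bounded integer or linear programs.) -/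
def LowerGap : Prop :=
  ∃ p : Polynomial ℕ, ∀ (i : Word) (x : FracVec (P.nx i)) (v : FracVec (P.ny i)),
    x.val ∈ P.X i → v.val ∈ P.lowerFeasible i x.val →
    (∃ y ∈ P.lowerFeasible i x.val, P.f i x.val y < P.f i x.val v.val) →
    ∃ y ∈ P.lowerFeasible i x.val,
      P.f i x.val y ≤
        P.f i x.val v.val - (1 / 2) ^ p.eval (encTuple [i, encVec x, encVec v]).length

/-- Violation of an upper-level constraint by a near-optimal lower-level decision is visible at
polynomial precision. -/
def AdversarialGap (δ : Word → ℝ) : Prop :=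
  ∃ p : Polynomial ℕ, ∀ (i : Word) (x : FracVec (P.nx i)) (v : FracVec (P.ny i)) (k : Fin (P.mu i)),
    x.val ∈ P.X i → v.val ∈ P.lowerOptimal i x.val →
    (∃ z ∈ P.nearOptimal (δ i) i x.val v.val, 0 < P.G i k x.val z) →
    ∃ z ∈ P.nearOptimal (δ i) i x.val v.val,
      (1 / 2) ^ p.eval (encTuple [i, encVec x, encVec v]).length ≤ P.G i k x.val z

/-- Polynomial size of solutions: if the bound `γ` is attained on `S i`, it is attained at a
rational point whose encoding length is polynomial in that of `(i, γ)`. -/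
def SmallSolutions (S : ∀ i, Set ((Fin (P.nx i) → ℝ) × (Fin (P.ny i) → ℝ))) : Prop :=
  ∃ p : Polynomial ℕ, ∀ (i : Word) (γ : Frac),
    AttainsBound (S i) (fun q => P.F i q.1 q.2) γ.val →
    ∃ (x : FracVec (P.nx i)) (v : FracVec (P.ny i)),
      (x.val, v.val) ∈ S i ∧ P.F i x.val v.val ≤ γ.val ∧
      (encTuple [encVec x, encVec v]).length ≤ p.eval (encTuple [i, encFrac γ]).length

end BilevelProblem

/-!
A rational solution `(x, v)` of polynomial size serves as a certificate for the bilevel problem, and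
what has to be shown is that it can be verified in polynomial time with an oracle in NP.  Domain
membership, lower-level feasibility, the constraints `G k x v ≤ 0` and the bound on the objective
are evaluated directly.  The two remaining conditions quantify over all lower-level solutions and
are left to the oracle:

* by `LowerGap`, `v` is optimal iff no lower-level solution has a value of at most
  `f x v - 2 ^ (-p N)`, which is an instance of the lower-level problem
  (`exists_canonicalFeasible_test`);
* by `AdversarialGap`, the robustness condition for `G k` fails iff the objective `-G k x` takes a
  value of at most `-2 ^ (-p N)` on the epigraph `f x y ≤ u` with the additional linear constraint
  `0 ⬝ y + 1 * u ≤ f x v + δ`, which is an instance of the problem with objectives from `H`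
  (`exists_robustFeasible_test`).

Both problems are in NP, hence so is their tagged union (`taggedUnion_mem_NPRel`), which is the
single oracle that is used.

Most of the work is to show that the verifier runs in polynomial time in the given machine model.
`PolyComp O f` says that the function `f` between encoded types is computed in polynomial time by a
program that leaves its working registers empty.  By the frame property `Run.frame`, such programs
can be run while other registers hold intermediate results.  This gives closure under composition,
pairing, branching, oracle calls, and under folding over a word as long as the state grows by a
bounded amount in every step (`PolyComp.foldl`).  Everything else is programmed at the level of
functions: unary evaluation of polynomials, bounded quantifiers, and the arithmetic of binary
fractions that is needed to form the queries and to compare values.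
-/

/-! ### Structural facts about runs -/

/-- A strict upper bound for the registers that occur in a program. -/
def Prog.bound : Prog → ℕ
  | .skip => 0
  | .push r _ => r + 1
  | .pop r => r + 1
  | .query r s => max (r + 1) (s + 1)
  | .seq p q => max p.bound q.bound
  | .branch r p q s => max (r + 1) (max p.bound (max q.bound s.bound))
  | .loop r p => max (r + 1) p.bound

/-- The store that agrees with `σ` on the registers below `m` and with `τ` on all others. -/
def mergeStore (m : ℕ) (σ τ : Store) : Store := fun r => if r < m then σ r else τ r

theorem mergeStore_of_lt {m r : ℕ} (h : r < m) (σ τ : Store) : mergeStore m σ τ r = σ r :=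
  if_pos h

theorem mergeStore_update {m r : ℕ} (h : r < m) (σ τ : Store) (w : Word) :
    mergeStore m (Function.update σ r w) τ = Function.update (mergeStore m σ τ) r w := by
  funext s
  by_cases hs : s = r
  · subst hs; simp [mergeStore, h]
  · simp [mergeStore, hs]

/-- Frame property: a run does not depend on, and does not change, registers that do not occur in
the program. -/
theorem Run.frame {O : Language Bool} {p : Prog} {σ σ' : Store} {t : ℕ} (h : Run O p σ σ' t)
    {m : ℕ} (hm : p.bound ≤ m) (τ : Store) :
    Run O p (mergeStore m σ τ) (mergeStore m σ' τ) t := by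
  induction h with
  | skip σ => exact .skip _
  | push r b σ =>
    have hr : r < m := hm
    rw [mergeStore_update hr]
    simpa [mergeStore_of_lt hr] using Run.push (O := O) r b (mergeStore m σ τ)
  | pop r σ =>
    have hr : r < m := hm
    rw [mergeStore_update hr]
    simpa [mergeStore_of_lt hr] using Run.pop (O := O) r (mergeStore m σ τ)
  | query_yes r s σ h =>
    simp only [Prog.bound, max_le_iff] at hm
    have hr : r < m := hm.1
    have hs : s < m := hm.2
    rw [mergeStore_update hs]
    simpa [mergeStore_of_lt hs] using
      Run.query_yes (O := O) r s (mergeStore m σ τ) (by rwa [mergeStore_of_lt hr])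
  | query_no r s σ h =>
    simp only [Prog.bound, max_le_iff] at hm
    have hr : r < m := hm.1
    have hs : s < m := hm.2
    rw [mergeStore_update hs]
    simpa [mergeStore_of_lt hs] using
      Run.query_no (O := O) r s (mergeStore m σ τ) (by rwa [mergeStore_of_lt hr])
  | seq _ _ ihp ihq =>
    simp only [Prog.bound, max_le_iff] at hm
    exact .seq (ihp hm.1) (ihq hm.2)
  | branch_empty h _ ih =>
    simp only [Prog.bound, max_le_iff] at hm
    exact .branch_empty (by rwa [mergeStore_of_lt hm.1]) (ih hm.2.1)
  | branch_false h _ ih =>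
    simp only [Prog.bound, max_le_iff] at hm
    exact .branch_false (by rwa [mergeStore_of_lt hm.1]) (ih hm.2.2.1)
  | branch_true h _ ih =>
    simp only [Prog.bound, max_le_iff] at hm
    exact .branch_true (by rwa [mergeStore_of_lt hm.1]) (ih hm.2.2.2)
  | loop_done h =>
    simp only [Prog.bound, max_le_iff] at hm
    exact .loop_done (by rwa [mergeStore_of_lt hm.1])
  | loop_step h _ _ ihp ihl =>
    have hm' := hm
    simp only [Prog.bound, max_le_iff] at hm
    exact .loop_step (by rwa [mergeStore_of_lt hm.1]) (ihp hm.2) (ihl hm')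

theorem Run.eq_of_bound_le {O : Language Bool} {p : Prog} {σ σ' : Store} {t : ℕ}
    (h : Run O p σ σ' t) {r : ℕ} (hr : p.bound ≤ r) : σ' r = σ r := by
  induction h with
  | skip | loop_done => rfl
  | push s b σ | pop s σ => exact Function.update_of_ne (by simp [Prog.bound] at hr; omega) _ _
  | query_yes _ s σ | query_no _ s σ =>
    exact Function.update_of_ne (by simp [Prog.bound] at hr; omega) _ _
  | seq _ _ ihp ihq =>
    simp only [Prog.bound, max_le_iff] at hr
    rw [ihq hr.2, ihp hr.1]
  | branch_empty h _ ih => simp only [Prog.bound, max_le_iff] at hr; exact ih hr.2.1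
  | branch_false h _ ih => simp only [Prog.bound, max_le_iff] at hr; exact ih hr.2.2.1
  | branch_true h _ ih => simp only [Prog.bound, max_le_iff] at hr; exact ih hr.2.2.2
  | loop_step h _ _ ihp ihl =>
    rw [ihl hr]
    simp only [Prog.bound, max_le_iff] at hr
    exact ihp hr.2

/-- A register grows by at most one bit per step. -/
theorem Run.length_le {O : Language Bool} {p : Prog} {σ σ' : Store} {t : ℕ}
    (h : Run O p σ σ' t) (r : ℕ) : (σ' r).length ≤ (σ r).length + t := by
  induction h with
  | skip | loop_done => omega
  | push s _ σ | pop s σ | query_yes _ s σ | query_no _ s σ =>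
    by_cases hs : r = s
    · subst hs; simp; try omega
    · simp [Function.update_of_ne hs]
  | seq _ _ ihp ihq => omega
  | branch_empty | branch_false | branch_true => omega
  | loop_step => omega

/-- The program that replaces every oracle call by the answer `no`. -/
def Prog.noQuery : Prog → Prog
  | .query _ s => .push s false
  | .seq p q => .seq p.noQuery q.noQuery
  | .branch r p q s => .branch r p.noQuery q.noQuery s.noQuery
  | .loop r p => .loop r p.noQuery
  | p => p

theorem Run.noQuery {p : Prog} {σ σ' : Store} {t : ℕ} (h : Run 0 p σ σ' t)
    (O : Language Bool) : Run O p.noQuery σ σ' t := by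
  induction h with
  | skip σ => exact .skip _
  | push r b σ => exact .push ..
  | pop r σ => exact .pop ..
  | query_yes r s σ h => exact absurd h (by simp)
  | query_no r s σ h => exact .push ..
  | seq _ _ ihp ihq => exact .seq ihp ihq
  | branch_empty h _ ih => exact .branch_empty h ih
  | branch_false h _ ih => exact .branch_false h ih
  | branch_true h _ ih => exact .branch_true h ih
  | loop_done h => exact .loop_done h
  | loop_step h _ _ ihp ihl => exact .loop_step h ihp ihl

/-! ### Runs within a time bound -/

/-- With oracle `O`, the program `p` started in `σ` halts in `σ'` after at most `n` steps. -/
def RunsWithin (O : Language Bool) (p : Prog) (σ σ' : Store) (n : ℕ) : Prop :=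
  ∃ t ≤ n, Run O p σ σ' t

namespace RunsWithin

variable {O : Language Bool} {p q : Prog} {σ σ' σ'' : Store} {m n : ℕ}

theorem mono (h : RunsWithin O p σ σ' n) (hn : n ≤ m) : RunsWithin O p σ σ' m :=
  let ⟨t, ht, hr⟩ := h; ⟨t, ht.trans hn, hr⟩

theorem seq (hp : RunsWithin O p σ σ' n) (hq : RunsWithin O q σ' σ'' m) :
    RunsWithin O (.seq p q) σ σ'' (n + m) :=
  let ⟨_, ht, hr⟩ := hp
  let ⟨_, ht', hr'⟩ := hq
  ⟨_, Nat.add_le_add ht ht', hr.seq hr'⟩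

theorem skip (σ : Store) : RunsWithin O .skip σ σ 1 := ⟨1, le_rfl, .skip σ⟩

theorem push {r : ℕ} {b : Bool} (h : σ' = Function.update σ r (b :: σ r)) :
    RunsWithin O (.push r b) σ σ' 1 := ⟨1, le_rfl, h ▸ .push r b σ⟩

theorem pop {r : ℕ} (h : σ' = Function.update σ r (σ r).tail) :
    RunsWithin O (.pop r) σ σ' 1 := ⟨1, le_rfl, h ▸ .pop r σ⟩

/-- Empty a register bit by bit, running `q b` for every bit `b`.  Here `st w x` is the store in
which the register holds `w` and the remaining registers represent `x`. -/
theorem drain {β : Type*} {r : ℕ} {q : Bool → Prog} {st : Word → β → Store} {g : β → Bool → β}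
    {K : ℕ} (hst : ∀ w x, st w x r = w)
    (hupd : ∀ b w x, Function.update (st (b :: w) x) r w = st w x) (w : Word) :
    ∀ x, (∀ w₁ b w₂, w = w₁ ++ b :: w₂ → RunsWithin O (q b) (st w₂ (w₁.foldl g x))
        (st w₂ (g (w₁.foldl g x) b)) K) →
      RunsWithin O (.loop r (.branch r .skip (.seq (.pop r) (q false)) (.seq (.pop r) (q true))))
        (st w x) (st [] (w.foldl g x)) ((K + 3) * w.length + 1) := by
  induction w with
  | nil => exact fun x _ => ⟨1, by simp, .loop_done (hst _ _)⟩
  | cons b w ih =>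
    intro x hq
    obtain ⟨t, ht, hr⟩ := hq [] b w rfl
    obtain ⟨t', ht', hr'⟩ := ih (g x b) fun w₁ b' w₂ h => hq (b :: w₁) b' w₂ (by simp [h])
    have hpop : Run O (.pop r) (st (b :: w) x) (st w x) 1 := by
      have := Run.pop (O := O) r (st (b :: w) x)
      rwa [hst, List.tail_cons, hupd] at this
    refine ⟨1 + t + 1 + t' + 1, ?_, .loop_step (by simp [hst]) ?_ hr'⟩
    · simp only [List.length_cons, Nat.mul_add, Nat.mul_one]; omega
    · cases b
      · exact .branch_false (hst _ _) (hpop.seq hr)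
      · exact .branch_true (hst _ _) (hpop.seq hr)

/-- A version of `RunsWithin.drain` for bodies that run in constant time in every store. -/
theorem drain_const {β : Type*} {r : ℕ} {q : Bool → Prog} (st : Word → β → Store)
    (g : β → Bool → β) {K : ℕ} (hst : ∀ w x, st w x r = w)
    (hupd : ∀ b w x, Function.update (st (b :: w) x) r w = st w x)
    (hq : ∀ b w x, RunsWithin O (q b) (st w x) (st w (g x b)) K) (w : Word) (x : β) :
    RunsWithin O (.loop r (.branch r .skip (.seq (.pop r) (q false)) (.seq (.pop r) (q true))))
        (st w x) (st [] (w.foldl g x)) ((K + 3) * w.length + 1) :=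
  drain hst hupd w x fun _ _ _ _ => hq _ _ _

theorem clear (r : ℕ) (σ : Store) :
    RunsWithin O (.loop r (.pop r)) σ (Function.update σ r []) (2 * (σ r).length + 1) := by
  generalize hw : σ r = w
  induction w generalizing σ with
  | nil => exact ⟨1, by simp, by rw [← hw, Function.update_eq_self]; exact .loop_done hw⟩
  | cons b w ih =>
    obtain ⟨t, ht, hr⟩ := ih (Function.update σ r w) (by simp)
    rw [Function.update_idem] at hr
    refine ⟨1 + t + 1, by simp; omega, .loop_step (by simp [hw]) (.pop r σ) ?_⟩
    simpa [hw] using hr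

end RunsWithin

/-- The program that empties the registers `1, …, n`. -/
def Prog.clearUpTo : ℕ → Prog
  | 0 => .skip
  | n + 1 => .seq (clearUpTo n) (.loop (n + 1) (.pop (n + 1)))

theorem RunsWithin.clearUpTo (O : Language Bool) (n B : ℕ) (σ : Store)
    (hB : ∀ r, (σ r).length ≤ B) :
    RunsWithin O (.clearUpTo n) σ (fun r => if 0 < r ∧ r ≤ n then [] else σ r)
      (n * (2 * B + 1) + 1) := by
  induction n with
  | zero =>
    have : (fun r => if 0 < r ∧ r ≤ 0 then [] else σ r) = σ := by
      funext r; rw [if_neg (by omega)]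
    rw [this]
    exact (RunsWithin.skip σ).mono (by omega)
  | succ n ih =>
    have h := ih.seq (RunsWithin.clear (n + 1) _)
    have hσ : Function.update (fun r => if 0 < r ∧ r ≤ n then [] else σ r) (n + 1) [] =
        fun r => if 0 < r ∧ r ≤ n + 1 then [] else σ r := by
      funext r
      by_cases hr : r = n + 1
      · subst hr; simp
      · rw [Function.update_of_ne hr]
        by_cases h : 0 < r ∧ r ≤ n
        · rw [if_pos h, if_pos (by omega)]
        · rw [if_neg h, if_neg (by omega)]
    rw [hσ] at h
    refine h.mono ?_
    have := hB (n + 1)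
    rw [if_neg (by omega), Nat.add_mul]
    omega

/-! ### Moving words between registers -/

/-- The store with `a` in register `0`, `b` in register `M` and `c` in register `M + 1`. -/
def store₃ (M : ℕ) (a b c : Word) : Store := fun r =>
  if r = 0 then a else if r = M then b else if r = M + 1 then c else []

section store₃

variable {M : ℕ} (a b c w : Word)

@[simp] theorem store₃_zero : store₃ M a b c 0 = a := rfl

@[simp] theorem store₃_fst (hM : 0 < M) : store₃ M a b c M = b := by
  simp [store₃, hM.ne']

@[simp] theorem store₃_snd : store₃ M a b c (M + 1) = c := by
  simp [store₃]

@[simp] theorem update_store₃_zero : Function.update (store₃ M a b c) 0 w = store₃ M w b c := by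
  funext r
  by_cases hr : r = 0
  · subst hr; simp
  · simp [hr, store₃]

@[simp] theorem update_store₃_fst (hM : 0 < M) :
    Function.update (store₃ M a b c) M w = store₃ M a w c := by
  funext r
  by_cases hr : r = M
  · subst hr; simp [hM]
  · simp [hr, store₃]

@[simp] theorem update_store₃_snd :
    Function.update (store₃ M a b c) (M + 1) w = store₃ M a b w := by
  funext r
  by_cases hr : r = M + 1
  · subst hr; simp
  · simp [hr, store₃]

theorem initStore_eq_store₃ (M : ℕ) : initStore a = store₃ M a [] [] := by
  funext r
  by_cases hr : r = 0
  · subst hr; simp [initStore]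
  · simp [initStore, store₃, hr]

/-- A clean program with small registers, run on a store whose registers `M` and `M + 1` hold saved
words. -/
theorem RunsWithin.frame_store₃ {O : Language Bool} {p : Prog} {s s' : Word} {n : ℕ}
    (h : RunsWithin O p (initStore s) (initStore s') n) (hM : 0 < M) (hp : p.bound ≤ M) :
    RunsWithin O p (store₃ M s b c) (store₃ M s' b c) n := by
  have key : ∀ s, mergeStore M (initStore s) (store₃ M [] b c) = store₃ M s b c := by
    intro s
    funext r
    by_cases hr : r = 0
    · subst hr; simp [mergeStore, hM, initStore]
    · by_cases hr' : r < M
      · simp only [mergeStore, hr', if_true, initStore, Function.update_of_ne hr, store₃, hr,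
          if_false, hr'.ne]
        rw [if_neg (by omega)]
      · simp [mergeStore, hr', store₃, hr]
  obtain ⟨t, ht, hr⟩ := h
  have := hr.frame hp (store₃ M [] b c)
  rw [key, key] at this
  exact ⟨t, ht, this⟩

end store₃

section

variable {O : Language Bool}

/-- The program that pushes a given word onto register `0`. -/
def Prog.pushWord : Word → Prog
  | [] => .skip
  | b :: w => .seq (pushWord w) (.push 0 b)

theorem RunsWithin.pushWord (w s : Word) :
    RunsWithin O (.pushWord w) (initStore s) (initStore (w ++ s)) (w.length + 1) := by
  induction w with
  | nil => exact .skip _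
  | cons b w ih =>
    refine (ih.seq (.push ?_)).mono (by simp)
    simp [initStore]

/-- Copy register `0` in reverse order to the (empty) register `M`, by way of register `M + 1`. -/
def Prog.save (M : ℕ) : Prog :=
  .seq
    (.loop 0 (.branch 0 .skip (.seq (.pop 0) (.seq (.push M false) (.push (M + 1) false)))
      (.seq (.pop 0) (.seq (.push M true) (.push (M + 1) true)))))
    (.loop (M + 1) (.branch (M + 1) .skip (.seq (.pop (M + 1)) (.push 0 false))
      (.seq (.pop (M + 1)) (.push 0 true))))

theorem List.foldl_flip_cons (w l : Word) :
    w.foldl (fun x b => b :: x) l = w.reverse ++ l := by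
  induction w generalizing l with
  | nil => rfl
  | cons b w ih => simp [ih]

theorem RunsWithin.save {M : ℕ} (hM : 0 < M) (s : Word) :
    RunsWithin O (.save M) (store₃ M s [] []) (store₃ M s s.reverse []) (9 * s.length + 2) := by
  have h1 := RunsWithin.drain_const (O := O) (r := 0) (K := 2)
    (q := fun b => .seq (.push M b) (.push (M + 1) b)) (fun w x => store₃ M w x x)
    (fun x b => b :: x) (by simp) (by simp)
    (fun b w x => (RunsWithin.push (σ' := store₃ M w (b :: x) x) (by simp [hM])).seq
      (.push (by simp))) s []
  have h2 := RunsWithin.drain_const (O := O) (r := M + 1) (K := 1)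
    (q := fun b => .push 0 b) (fun w x => store₃ M x s.reverse w)
    (fun x b => b :: x) (by simp) (by simp)
    (fun b w x => RunsWithin.push (by simp)) s.reverse []
  rw [List.foldl_flip_cons] at h1 h2
  simp only [List.append_nil, List.reverse_reverse, List.length_reverse] at h1 h2
  exact (h1.seq h2).mono (by omega)

/-- Move register `r` in reverse order onto register `s`. -/
def Prog.move (r s : ℕ) : Prog :=
  .loop r (.branch r .skip (.seq (.pop r) (.push s false)) (.seq (.pop r) (.push s true)))

/-- Restore the contents of register `0` from the reverse copy in register `M`. -/
theorem RunsWithin.move_fst_zero {M : ℕ} (hM : 0 < M) (a b c : Word) :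
    RunsWithin O (.move M 0) (store₃ M a b c) (store₃ M (b.reverse ++ a) [] c)
      (4 * b.length + 1) := by
  rw [← List.foldl_flip_cons]
  exact RunsWithin.drain_const (O := O) (r := M) (K := 1)
    (q := fun b => .push 0 b) (fun w x => store₃ M x w c)
    (fun x b => b :: x) (by simp [hM]) (by simp [hM])
    (fun b w x => RunsWithin.push (by simp)) b a

theorem RunsWithin.move_zero_snd {M : ℕ} (a b c : Word) :
    RunsWithin O (.move 0 (M + 1)) (store₃ M a b c) (store₃ M [] b (a.reverse ++ c))
      (4 * a.length + 1) := by
  rw [← List.foldl_flip_cons]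
  exact RunsWithin.drain_const (O := O) (r := 0) (K := 1)
    (q := fun b => .push (M + 1) b) (fun w x => store₃ M w b x)
    (fun x b => b :: x) (by simp) (by simp)
    (fun b w x => RunsWithin.push (by simp)) a c

theorem RunsWithin.move_snd_fst {M : ℕ} (hM : 0 < M) (a b c : Word) :
    RunsWithin O (.move (M + 1) M) (store₃ M a b c) (store₃ M a (c.reverse ++ b) [])
      (4 * c.length + 1) := by
  rw [← List.foldl_flip_cons]
  exact RunsWithin.drain_const (O := O) (r := M + 1) (K := 1)
    (q := fun b => .push M b) (fun w x => store₃ M a x w)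
    (fun x b => b :: x) (by simp) (by simp)
    (fun b w x => RunsWithin.push (by simp [hM])) c b

/-- Prefix register `0` with the self-delimiting form of the reverse of register `M + 1`. -/
def Prog.emitDelimited (M : ℕ) : Prog :=
  .seq (.push 0 false)
    (.loop (M + 1) (.branch (M + 1) .skip
      (.seq (.pop (M + 1)) (.seq (.push 0 false) (.push 0 true)))
      (.seq (.pop (M + 1)) (.seq (.push 0 true) (.push 0 true)))))

theorem RunsWithin.emitDelimited {M : ℕ} (a c : Word) :
    RunsWithin O (.emitDelimited M)
      (store₃ M a [] c) (store₃ M (delimit c.reverse ++ a) [] []) (5 * c.length + 2) := by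
  have h1 := RunsWithin.drain_const (O := O) (r := M + 1) (K := 2)
    (q := fun b => .seq (.push 0 b) (.push 0 true)) (fun w x => store₃ M x [] w)
    (fun x b => true :: b :: x) (by simp) (by simp)
    (fun b w x => (RunsWithin.push (σ' := store₃ M (b :: x) [] w) (by simp)).seq
      (.push (by simp))) c (false :: a)
  have h2 : c.foldl (fun x b => true :: b :: x) (false :: a) = delimit c.reverse ++ a := by
    rw [← List.foldr_reverse]
    generalize c.reverse = d
    induction d with
    | nil => simp [delimit]
    | cons b d ih => simp [delimit] at ih ⊢; exact ih
  rw [h2] at h1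
  exact ((RunsWithin.push (σ' := store₃ M (false :: a) [] c) (by simp)).seq h1).mono (by omega)

end

theorem Polynomial.eval_le_eval_of_le (T : Polynomial ℕ) {m n : ℕ} (h : m ≤ n) :
    T.eval m ≤ T.eval n := by
  induction T using Polynomial.induction_on' with
  | add p q hp hq => simpa using Nat.add_le_add hp hq
  | monomial k a => simpa using Nat.mul_le_mul_left a (Nat.pow_le_pow_left h k)

/-! ### Polynomial-time computable functions between encoded types -/

/-- Types whose elements are encoded by words. -/
class WordEncoding (α : Type) where
  enc : α → Word

open WordEncoding

instance : WordEncoding Word := ⟨id⟩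
instance : WordEncoding Bool := ⟨fun b => [b]⟩

/-- A pair is encoded by the self-delimiting form of the first component followed by the second
component.  Thus `encTuple [u, v]` encodes the nested pair `(u, v, [])`. -/
instance {α β : Type} [WordEncoding α] [WordEncoding β] : WordEncoding (α × β) :=
  ⟨fun x => delimit (enc x.1) ++ enc x.2⟩

@[simp] theorem enc_word (w : Word) : enc w = w := rfl
@[simp] theorem enc_bool (b : Bool) : enc b = [b] := rfl
@[simp] theorem enc_pair {α β : Type} [WordEncoding α] [WordEncoding β] (x : α × β) :
    enc x = delimit (enc x.1) ++ enc x.2 := rfl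

@[simp] theorem length_delimit (w : Word) : (delimit w).length = 2 * w.length + 1 := by
  induction w with
  | nil => rfl
  | cons b w ih => simp [delimit] at ih ⊢; omega

/-- With oracle `O`, the function `f` between encoded types is computable in polynomial time by a
program that leaves all registers except the output register `0` empty. -/
@[fun_prop]
def PolyComp (O : Language Bool) {α β : Type} [WordEncoding α] [WordEncoding β] (f : α → β) :
    Prop :=
  ∃ (p : Prog) (T : Polynomial ℕ), ∀ a,
    RunsWithin O p (initStore (enc a)) (initStore (enc (f a))) (T.eval (enc a).length)

namespace PolyComp

variable {O : Language Bool} {α β γ : Type} [WordEncoding α] [WordEncoding β] [WordEncoding γ]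

/-- Computability depends on the encodings of the arguments and values only. -/
theorem of_enc_eq {f : α → β} {α' β' : Type} [WordEncoding α'] [WordEncoding β'] {f' : α' → β'}
    (h : PolyComp O f) (e : α' → α) (he : ∀ a, enc (e a) = enc a)
    (hf : ∀ a, enc (f (e a)) = enc (f' a)) : PolyComp O f' := by
  obtain ⟨p, T, h⟩ := h
  refine ⟨p, T, fun a => ?_⟩
  rw [← he, ← hf]
  exact h _

theorem length_bound {f : α → β} (h : PolyComp O f) :
    ∃ q : Polynomial ℕ, ∀ a, (enc (f a)).length ≤ q.eval (enc a).length := by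
  obtain ⟨p, T, h⟩ := h
  refine ⟨T + .X, fun a => ?_⟩
  obtain ⟨t, ht, hr⟩ := h a
  have := hr.length_le 0
  simp [initStore] at this ⊢
  omega

/-- The word encoding a value, and the value itself, are the same data. -/
theorem enc_fun : PolyComp O (enc : α → Word) :=
  ⟨.skip, 1, fun a => by simpa using RunsWithin.skip _⟩

@[fun_prop]
theorem id : PolyComp O (fun a : α => a) :=
  ⟨.skip, 1, fun a => by simpa using RunsWithin.skip _⟩

@[fun_prop]
theorem comp {g : β → γ} {f : α → β} (hg : PolyComp O g) (hf : PolyComp O f) :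
    PolyComp O (fun a => g (f a)) := by
  obtain ⟨q, hq⟩ := hf.length_bound
  obtain ⟨pf, Tf, hf⟩ := hf
  obtain ⟨pg, Tg, hg⟩ := hg
  refine ⟨.seq pf pg, Tf + Tg.comp q, fun a => ((hf a).seq (hg _)).mono ?_⟩
  simpa using Tg.eval_le_eval_of_le (hq a)

@[fun_prop]
theorem const (b : β) : PolyComp O (fun _ : α => b) := by
  refine ⟨.seq (.loop 0 (.pop 0)) (.pushWord (enc b)), 2 * .X + 1 + ((enc b).length + 1 : ℕ),
    fun a => ?_⟩
  have h1 := RunsWithin.clear (O := O) 0 (initStore (enc a))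
  have h2 := RunsWithin.pushWord (O := O) (enc b) []
  have : Function.update (initStore (enc a)) 0 [] = initStore [] := by simp [initStore]
  rw [this] at h1
  rw [List.append_nil] at h2
  refine (h1.seq h2).mono ?_
  simp [initStore]

@[fun_prop]
theorem prodMk {f : α → β} {g : α → γ} (hf : PolyComp O f) (hg : PolyComp O g) :
    PolyComp O (fun a => (f a, g a)) := by
  obtain ⟨q, hq⟩ := hf.length_bound
  obtain ⟨pf, Tf, hf⟩ := hf
  obtain ⟨pg, Tg, hg⟩ := hg
  set M := max 1 (max pf.bound pg.bound) with hMdef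
  have hM : 0 < M := by omega
  refine ⟨.seq (.save M) (.seq pf (.seq (.move 0 (M + 1)) (.seq (.move M 0) (.seq pg
      (.emitDelimited M))))),
    9 * .X + 2 + (Tf + (4 * q + 1 + (4 * .X + 1 + (Tg + (5 * q + 2))))), fun a => ?_⟩
  have h1 := RunsWithin.save (O := O) hM (enc a)
  have h2 := (hf a).frame_store₃ (enc a).reverse [] hM (by omega)
  have h3 := RunsWithin.move_zero_snd (O := O) (M := M) (enc (f a)) (enc a).reverse []
  have h4 := RunsWithin.move_fst_zero (O := O) hM [] (enc a).reverse (enc (f a)).reverse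
  have h5 := (hg a).frame_store₃ [] (enc (f a)).reverse hM (by omega)
  have h6 := RunsWithin.emitDelimited (O := O) (M := M) (enc (g a)) (enc (f a)).reverse
  simp only [List.append_nil, List.reverse_reverse, List.length_reverse] at h3 h4 h6
  rw [initStore_eq_store₃ _ M, initStore_eq_store₃ _ M]
  refine (h1.seq (h2.seq (h3.seq (h4.seq (h5.seq h6))))).mono ?_
  have := hq a
  simp
  omega

/-- Branching on a word computed from the input: empty, first bit `false`, first bit `true`. -/
@[fun_prop]
theorem wordCases {c : α → Word} {f₁ f₂ f₃ : α → β} (hc : PolyComp O c) (h₁ : PolyComp O f₁)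
    (h₂ : PolyComp O f₂) (h₃ : PolyComp O f₃) :
    PolyComp O (fun a => match c a with
      | [] => f₁ a
      | false :: _ => f₂ a
      | true :: _ => f₃ a) := by
  obtain ⟨q, hq⟩ := hc.length_bound
  obtain ⟨pc, Tc, hc⟩ := hc
  obtain ⟨p₁, T₁, h₁⟩ := h₁
  obtain ⟨p₂, T₂, h₂⟩ := h₂
  obtain ⟨p₃, T₃, h₃⟩ := h₃
  set M := max 1 (max pc.bound (max p₁.bound (max p₂.bound p₃.bound))) with hMdef
  have hM : 0 < M := by omega
  -- After the test, register `0` is cleared and the input is restored from its copy.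
  let rest (p : Prog) : Prog := .seq (.loop 0 (.pop 0)) (.seq (.move M 0) p)
  refine ⟨.seq (.save M) (.seq pc (.branch 0 (rest p₁) (rest p₂) (rest p₃))),
    9 * .X + 2 + (Tc + (2 * q + 1 + (4 * .X + 1 + (T₁ + T₂ + T₃)) + 1)), fun a => ?_⟩
  have h1 := RunsWithin.save (O := O) hM (enc a)
  have h2 := (hc a).frame_store₃ (enc a).reverse [] hM (by omega)
  have h3 := RunsWithin.clear (O := O) 0 (store₃ M (enc (c a)) (enc a).reverse [])
  have h4 := RunsWithin.move_fst_zero (O := O) hM [] (enc a).reverse []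
  simp only [List.append_nil, List.reverse_reverse, List.length_reverse, update_store₃_zero,
    store₃_zero] at h3 h4
  have hrest : ∀ (p : Prog) (f : α → β) (T : Polynomial ℕ), p.bound ≤ M →
      RunsWithin O p (initStore (enc a)) (initStore (enc (f a))) (T.eval (enc a).length) →
      RunsWithin O (rest p) (store₃ M (enc (c a)) (enc a).reverse []) (initStore (enc (f a)))
        (2 * q.eval (enc a).length + 1 + (4 * (enc a).length + 1 + T.eval (enc a).length)) := by
    intro p f T hp h
    have h5 := h.frame_store₃ [] [] hM hp
    rw [← initStore_eq_store₃ (enc (f a)) M] at h5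
    refine (h3.seq (h4.seq h5)).mono ?_
    have := hq a
    omega
  rw [initStore_eq_store₃ (enc a) M]
  refine (h1.seq (h2.seq (m := 2 * q.eval (enc a).length + 1 + (4 * (enc a).length + 1 +
    (T₁.eval (enc a).length + T₂.eval (enc a).length + T₃.eval (enc a).length)) + 1) ?_)).mono ?_
  · rcases hca : c a with _ | ⟨_ | _, w⟩
    · obtain ⟨t, ht, hr⟩ := hrest p₁ f₁ T₁ (by omega) (h₁ a)
      exact ⟨t + 1, by omega, .branch_empty (by simp) (by
        simp only [hca]; rw [hca] at hr; exact hr)⟩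
    · obtain ⟨t, ht, hr⟩ := hrest p₂ f₂ T₂ (by omega) (h₂ a)
      exact ⟨t + 1, by omega, .branch_false (w := w) (by simp) (by
        simp only [hca]; rw [hca] at hr; exact hr)⟩
    · obtain ⟨t, ht, hr⟩ := hrest p₃ f₃ T₃ (by omega) (h₃ a)
      exact ⟨t + 1, by omega, .branch_true (w := w) (by simp) (by
        simp only [hca]; rw [hca] at hr; exact hr)⟩
  · simp

/-- Bounded iteration: folding over a word computed from the input.  In order to stay within
polynomial time, one step may enlarge the encoding of the state by at most `g`, where `g` is a
quantity that does not increase and that is initially polynomial in the input. -/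
theorem foldl {l : α → Word} {init : α → β} {step : β → Bool → β} (hl : PolyComp O l)
    (hinit : PolyComp O init) (hstep : ∀ b, PolyComp O fun s => step s b) (g : β → ℕ)
    (hg : ∀ s b, g (step s b) ≤ g s)
    (hlen : ∀ s b, (enc (step s b)).length ≤ (enc s).length + g s)
    (hginit : ∃ q : Polynomial ℕ, ∀ a, g (init a) ≤ q.eval (enc a).length) :
    PolyComp O (fun a => (l a).foldl step (init a)) := by
  obtain ⟨ql, hql⟩ := hl.length_bound
  obtain ⟨qi, hqi⟩ := hinit.length_bound
  obtain ⟨qg, hqg⟩ := hginit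
  have hgw : ∀ (w : Word) (s : β), g (w.foldl step s) ≤ g s := by
    intro w
    induction w with
    | nil => exact fun s => le_rfl
    | cons b w ih => exact fun s => (ih _).trans (hg s b)
  have hlenw : ∀ (w : Word) (s : β),
      (enc (w.foldl step s)).length ≤ (enc s).length + w.length * g s := by
    intro w
    induction w with
    | nil => intro s; simp
    | cons b w ih =>
      intro s
      have h1 := ih (step s b)
      have h2 := hlen s b
      have h3 := Nat.mul_le_mul_left w.length (hg s b)
      simp only [List.foldl_cons, List.length_cons, Nat.add_mul]
      omega
  have hsize : ∀ (a : α) (w₁ w₂ : Word), l a = w₁ ++ w₂ →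
      (enc (w₁.foldl step (init a))).length ≤ (qi + ql * qg).eval (enc a).length := by
    intro a w₁ w₂ h
    refine (hlenw _ _).trans ?_
    have h1 : w₁.length ≤ (l a).length := by simp [h]
    simpa using Nat.add_le_add (hqi a) (Nat.mul_le_mul (h1.trans (hql a)) (hqg a))
  obtain ⟨pl, Tl, hl⟩ := hl
  obtain ⟨pi, Ti, hinit⟩ := hinit
  obtain ⟨pf, Tf, hf⟩ := hstep false
  obtain ⟨pt, Tt, ht⟩ := hstep true
  set M := max 1 (max pl.bound (max pi.bound (max pf.bound pt.bound))) with hMdef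
  have hM : 0 < M := by omega
  let q : Bool → Prog := fun b => if b then pt else pf
  -- Register `M` holds the rest of the word during the loop, register `0` the current state.
  refine ⟨.seq (.save M) (.seq pl (.seq (.move 0 (M + 1)) (.seq (.move M 0) (.seq pi
    (.seq (.move (M + 1) M) (.loop M (.branch M .skip (.seq (.pop M) (q false))
      (.seq (.pop M) (q true))))))))),
    9 * .X + 2 + (Tl + (4 * ql + 1 + (4 * .X + 1 + (Ti + (4 * ql + 1 +
      (((Tf + Tt).comp (qi + ql * qg) + 3) * ql + 1)))))), fun a => ?_⟩
  have h1 := RunsWithin.save (O := O) hM (enc a)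
  have h2 := (hl a).frame_store₃ (enc a).reverse [] hM (by omega)
  have h3 := RunsWithin.move_zero_snd (O := O) (M := M) (enc (l a)) (enc a).reverse []
  have h4 := RunsWithin.move_fst_zero (O := O) hM [] (enc a).reverse (enc (l a)).reverse
  have h5 := (hinit a).frame_store₃ [] (enc (l a)).reverse hM (by omega)
  have h6 := RunsWithin.move_snd_fst (O := O) hM (enc (init a)) [] (enc (l a)).reverse
  have h7 := RunsWithin.drain (O := O) (r := M) (q := q) (st := fun w x => store₃ M (enc x) w [])
    (g := step) (K := ((Tf + Tt).comp (qi + ql * qg)).eval (enc a).length) (by simp [hM])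
    (by simp [hM]) (l a) (init a) (by
      intro w₁ b w₂ h
      have h8 := hsize a w₁ _ h
      set s := w₁.foldl step (init a)
      rw [Polynomial.eval_comp, Polynomial.eval_add]
      cases b
      · refine RunsWithin.mono ((hf s).frame_store₃ w₂ [] hM (by omega)) ?_
        exact (Tf.eval_le_eval_of_le h8).trans (by omega)
      · refine RunsWithin.mono ((ht s).frame_store₃ w₂ [] hM (by omega)) ?_
        exact (Tt.eval_le_eval_of_le h8).trans (by omega))
  simp only [List.append_nil, List.reverse_reverse, List.length_reverse] at h3 h4 h6
  rw [initStore_eq_store₃ _ M, initStore_eq_store₃ _ M]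
  refine (h1.seq (h2.seq (h3.seq (h4.seq (h5.seq (h6.seq h7)))))).mono ?_
  have h8 : (l a).length ≤ ql.eval (enc a).length := hql a
  have h9 := Nat.mul_le_mul_left (((Tf + Tt).comp (qi + ql * qg)).eval (enc a).length + 3) h8
  simp only [Polynomial.eval_comp, Polynomial.eval_add, Polynomial.eval_mul, Polynomial.eval_X,
    Polynomial.eval_ofNat, Polynomial.eval_one, enc_word] at h9 ⊢
  omega

end PolyComp

/-! ### Decomposing words, branching, and oracle calls -/

/-- Split off a word in self-delimiting form; a left inverse of `(u, v) ↦ delimit u ++ v` that is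
defined on all words. -/
def undelimit : Word → Word × Word
  | [] => ([], [])
  | false :: v => ([], v)
  | [true] => ([], [])
  | true :: b :: w => (b :: (undelimit w).1, (undelimit w).2)

@[simp] theorem undelimit_delimit_append (u v : Word) : undelimit (delimit u ++ v) = (u, v) := by
  induction u with
  | nil => simp [delimit, undelimit]
  | cons b u ih =>
    have : delimit (b :: u) ++ v = true :: b :: (delimit u ++ v) := by simp [delimit]
    rw [this, undelimit, ih]

/-- One pass of `Prog.undelimit`; register `2` is the flag that keeps the loop running. -/
def Prog.undelimitStep : Prog :=
  .branch 0 (.pop 2) (.seq (.pop 0) (.pop 2))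
    (.seq (.pop 0) (.branch 0 .skip (.seq (.pop 0) (.push 1 false))
      (.seq (.pop 0) (.push 1 true))))

/-- Split off a word in self-delimiting form from register `0`; it is left in reverse order in
register `1`, and the remainder in register `0`. -/
def Prog.undelimit : Prog := .seq (.push 2 true) (.loop 2 undelimitStep)

theorem RunsWithin.undelimit_loop {O : Language Bool} (w : Word) (c : Word) :
    RunsWithin O (.loop 2 .undelimitStep) (store₃ 1 w c [true])
      (store₃ 1 (undelimit w).2 ((undelimit w).1.reverse ++ c) []) (6 * w.length + 6) := by
  have hdone : ∀ v c, Run O (.loop 2 .undelimitStep) (store₃ 1 v c []) (store₃ 1 v c []) 1 :=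
    fun v c => .loop_done rfl
  have hpop2 : ∀ v c, Run O (.pop 2) (store₃ 1 v c [true]) (store₃ 1 v c []) 1 := fun v c => by
    have := Run.pop (O := O) (1 + 1) (store₃ 1 v c [true])
    rwa [update_store₃_snd, store₃_snd] at this
  have hpop0 : ∀ b v c d, Run O (.pop 0) (store₃ 1 (b :: v) c d) (store₃ 1 v c d) 1 :=
    fun b v c d => by
      have := Run.pop (O := O) 0 (store₃ 1 (b :: v) c d)
      rwa [update_store₃_zero, store₃_zero] at this
  have hpush1 : ∀ b v c d, Run O (.push 1 b) (store₃ 1 v c d) (store₃ 1 v (b :: c) d) 1 :=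
    fun b v c d => by
      have := Run.push (O := O) 1 b (store₃ 1 v c d)
      rwa [update_store₃_fst _ _ _ _ one_pos, store₃_fst _ _ _ one_pos] at this
  have hne : ∀ v c, store₃ 1 v c [true] 2 ≠ [] := fun v c => by
    rw [show store₃ 1 v c [true] 2 = [true] from rfl]; simp
  induction w using undelimit.induct generalizing c with
  | case1 =>
    exact ⟨_, by simp, .loop_step (hne _ _) (.branch_empty rfl (hpop2 _ _)) (hdone _ _)⟩
  | case2 v =>
    exact ⟨_, by simp, .loop_step (hne _ _)
      (.branch_false rfl ((hpop0 _ _ _ _).seq (hpop2 _ _))) (hdone _ _)⟩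
  | case3 =>
    exact ⟨_, by simp, .loop_step (hne _ _)
      (.branch_true rfl ((hpop0 _ _ _ _).seq (.branch_empty rfl (.skip _))))
      (.loop_step (hne _ _) (.branch_empty rfl (hpop2 _ _)) (hdone _ _))⟩
  | case4 b w ih =>
    obtain ⟨t, ht, hr⟩ := ih (b :: c)
    have hrev : (b :: (undelimit w).1).reverse ++ c = (undelimit w).1.reverse ++ b :: c := by simp
    rw [undelimit, hrev]
    cases b
    · exact ⟨_, by simp; omega, .loop_step (hne _ _) (.branch_true rfl ((hpop0 _ _ _ _).seq
        (.branch_false rfl ((hpop0 _ _ _ _).seq (hpush1 _ _ _ _))))) hr⟩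
    · exact ⟨_, by simp; omega, .loop_step (hne _ _) (.branch_true rfl ((hpop0 _ _ _ _).seq
        (.branch_true rfl ((hpop0 _ _ _ _).seq (hpush1 _ _ _ _))))) hr⟩

theorem RunsWithin.undelimit {O : Language Bool} (w : Word) :
    RunsWithin O .undelimit (initStore w)
      (store₃ 1 (undelimit w).2 (undelimit w).1.reverse []) (6 * w.length + 7) := by
  have := (RunsWithin.undelimit_loop (O := O) w [])
  rw [List.append_nil] at this
  refine (RunsWithin.seq (RunsWithin.push ?_) this).mono (by omega)
  rw [initStore_eq_store₃ w 1]
  exact (update_store₃_snd _ _ _ _).symm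

theorem length_undelimit (w : Word) :
    (undelimit w).1.length + (undelimit w).2.length ≤ w.length := by
  induction w using undelimit.induct with
  | case1 | case2 | case3 => simp [undelimit]
  | case4 b w ih => simp [undelimit]; omega

namespace PolyComp

variable {O : Language Bool} {α β γ : Type} [WordEncoding α] [WordEncoding β] [WordEncoding γ]

theorem undelimit_fst : PolyComp O (fun w : Word => (undelimit w).1) := by
  refine ⟨.seq .undelimit (.seq (.loop 0 (.pop 0)) (.move 1 0)), 6 * .X + 7 + (2 * .X + 1 +
    (4 * .X + 1)), fun w => ?_⟩
  have h1 := RunsWithin.undelimit (O := O) w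
  have h2 := RunsWithin.clear (O := O) 0 (store₃ 1 (undelimit w).2 (undelimit w).1.reverse [])
  have h3 := RunsWithin.move_fst_zero (O := O) one_pos [] (undelimit w).1.reverse []
  rw [update_store₃_zero] at h2
  rw [List.append_nil, List.reverse_reverse, List.length_reverse] at h3
  rw [initStore_eq_store₃ (enc (undelimit w).1) 1]
  refine (h1.seq (h2.seq h3)).mono ?_
  have := length_undelimit w
  simp
  omega

theorem undelimit_snd : PolyComp O (fun w : Word => (undelimit w).2) := by
  refine ⟨.seq .undelimit (.loop 1 (.pop 1)), 6 * .X + 7 + (2 * .X + 1), fun w => ?_⟩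
  have h1 := RunsWithin.undelimit (O := O) w
  have h2 := RunsWithin.clear (O := O) 1 (store₃ 1 (undelimit w).2 (undelimit w).1.reverse [])
  rw [update_store₃_fst _ _ _ _ one_pos, store₃_fst _ _ _ one_pos] at h2
  rw [initStore_eq_store₃ (enc (undelimit w).2) 1]
  refine (h1.seq h2).mono ?_
  have := length_undelimit w
  simp
  omega

theorem fst : PolyComp O (fun x : α × β => x.1) :=
  (undelimit_fst.comp enc_fun).of_enc_eq (fun x : α × β => x) (fun _ => rfl) (fun x => by simp)

theorem snd : PolyComp O (fun x : α × β => x.2) :=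
  (undelimit_snd.comp enc_fun).of_enc_eq (fun x : α × β => x) (fun _ => rfl) (fun x => by simp)

@[fun_prop]
theorem comp_fst {f : α → β × γ} (hf : PolyComp O f) : PolyComp O (fun a => (f a).1) :=
  fst.comp hf

@[fun_prop]
theorem comp_snd {f : α → β × γ} (hf : PolyComp O f) : PolyComp O (fun a => (f a).2) :=
  snd.comp hf

@[fun_prop]
theorem undelimit {f : α → Word} (hf : PolyComp O f) : PolyComp O (fun a => undelimit (f a)) :=
  (undelimit_fst.comp hf).prodMk (undelimit_snd.comp hf)

@[fun_prop]
theorem cons {f : α → Word} (b : Bool) (hf : PolyComp O f) : PolyComp O (fun a => b :: f a) :=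
  comp (g := fun w : Word => (b :: w : Word)) ⟨.push 0 b, 1, fun w => by
    simpa using RunsWithin.push (by simp [initStore])⟩ hf

@[fun_prop]
theorem tail {f : α → Word} (hf : PolyComp O f) : PolyComp O (fun a => (f a).tail) :=
  comp (g := fun w : Word => (w.tail : Word)) ⟨.pop 0, 1, fun w => by
    simpa using RunsWithin.pop (by simp [initStore])⟩ hf

@[fun_prop]
theorem isEmpty {f : α → Word} (hf : PolyComp O f) : PolyComp O (fun a => (f a).isEmpty) := by
  convert hf.wordCases (const true) (const false) (const false) using 2 with a
  rcases f a with _ | ⟨_ | _, w⟩ <;> rfl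

@[fun_prop]
theorem headD {f : α → Word} (hf : PolyComp O f) : PolyComp O (fun a => (f a).headD false) := by
  convert hf.wordCases (const false) (const false) (const true) using 2 with a
  rcases f a with _ | ⟨_ | _, w⟩ <;> rfl

@[fun_prop]
theorem cond {c : α → Bool} {f g : α → β} (hc : PolyComp O c) (hf : PolyComp O f)
    (hg : PolyComp O g) : PolyComp O (fun a => bif c a then f a else g a) := by
  convert (enc_fun.comp hc).wordCases hg hg hf using 2 with a
  cases c a <;> rfl

@[fun_prop]
theorem bnot {f : α → Bool} (hf : PolyComp O f) : PolyComp O (fun a => !f a) := by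
  convert hf.cond (const false) (const true) using 2 with a
  cases f a <;> rfl

@[fun_prop]
theorem band {f g : α → Bool} (hf : PolyComp O f) (hg : PolyComp O g) :
    PolyComp O (fun a => f a && g a) := by
  convert hf.cond hg (const false) using 2 with a
  cases f a <;> rfl

@[fun_prop]
theorem bor {f g : α → Bool} (hf : PolyComp O f) (hg : PolyComp O g) :
    PolyComp O (fun a => f a || g a) := by
  convert hf.cond (const true) hg using 2 with a
  cases f a <;> rfl

@[fun_prop]
theorem bxor {f g : α → Bool} (hf : PolyComp O f) (hg : PolyComp O g) :
    PolyComp O (fun a => f a ^^ g a) := by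
  convert hf.cond hg.bnot hg using 2 with a
  cases f a <;> simp

@[fun_prop]
theorem cons_bool {c : α → Bool} {f : α → Word} (hc : PolyComp O c) (hf : PolyComp O f) :
    PolyComp O (fun a => c a :: f a) := by
  convert hc.cond (hf.cons true) (hf.cons false) using 2 with a
  cases c a <;> rfl

/-- A computation without an oracle can be carried out with any oracle. -/
theorem mono_zero {f : α → β} (hf : PolyComp 0 f) : PolyComp O f :=
  let ⟨p, T, h⟩ := hf
  ⟨p.noQuery, T, fun a => let ⟨t, ht, hr⟩ := h a; ⟨t, ht, hr.noQuery O⟩⟩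

open Classical in
/-- Asking the oracle. -/
theorem mem_oracle : PolyComp O (fun w : Word => decide (w ∈ O)) := by
  refine ⟨.seq (.query 0 1) (.seq (.loop 0 (.pop 0)) (.move 1 0)), 1 + (2 * .X + 1 + 5),
    fun w => ?_⟩
  have h1 : RunsWithin O (.query 0 1) (initStore w) (store₃ 1 w [decide (w ∈ O)] []) 1 := by
    have hs : store₃ 1 w [decide (w ∈ O)] [] =
        Function.update (initStore w) 1 (decide (w ∈ O) :: initStore w 1) := by
      rw [initStore_eq_store₃ w 1, update_store₃_fst _ _ _ _ one_pos, store₃_fst _ _ _ one_pos]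
    rw [hs]
    by_cases hw : w ∈ O
    · rw [decide_eq_true hw]; exact ⟨1, le_rfl, .query_yes _ _ _ hw⟩
    · rw [decide_eq_false hw]; exact ⟨1, le_rfl, .query_no _ _ _ hw⟩
  have h2 := RunsWithin.clear (O := O) 0 (store₃ 1 w [decide (w ∈ O)] [])
  have h3 := RunsWithin.move_fst_zero (O := O) one_pos [] [decide (w ∈ O)] []
  rw [update_store₃_zero] at h2
  rw [initStore_eq_store₃ (enc (decide (w ∈ O))) 1]
  refine (h1.seq (h2.seq h3)).mono ?_
  simp

/-- Leaving the working registers dirty makes no difference. -/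
theorem of_dirty {φ : Word → Word} (h : PolyTimeRel O φ) : PolyComp O φ := by
  obtain ⟨p, T, h⟩ := h
  refine ⟨.seq p (.clearUpTo p.bound), T + (p.bound * (2 * (.X + T) + 1) + 1 : Polynomial ℕ),
    fun w => ?_⟩
  obtain ⟨σ, t, hr, ht, hσ⟩ := h w
  have h1 : RunsWithin O p (initStore w) σ (T.eval w.length) := ⟨t, ht, hr⟩
  have h2 := RunsWithin.clearUpTo O p.bound (w.length + T.eval w.length) σ fun r => by
    refine (hr.length_le r).trans ?_
    have : (initStore w r).length ≤ w.length := by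
      by_cases hr : r = 0
      · subst hr; simp [initStore]
      · simp [initStore, hr]
    omega
  have h3 : (fun r => if 0 < r ∧ r ≤ p.bound then [] else σ r) = initStore (φ w) := by
    funext r
    by_cases hr0 : r = 0
    · subst hr0; simp [initStore, hσ]
    · by_cases hrb : r ≤ p.bound
      · rw [if_pos (by omega)]; simp [initStore, hr0]
      · rw [if_neg (by omega), hr.eq_of_bound_le (by omega)]; simp [initStore, hr0]
  rw [h3] at h2
  exact (h1.seq h2).mono (by simp)

theorem polyTimeRel {φ : Word → Word} (h : PolyComp O φ) : PolyTimeRel O φ :=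
  let ⟨p, T, h⟩ := h
  ⟨p, T, fun s => let ⟨t, ht, hr⟩ := h s; ⟨_, t, hr, ht, by simp [initStore]⟩⟩

open Classical in
theorem of_mem_PRel {L : Language Bool} (h : L ∈ PRel O) :
    PolyComp O (fun w : Word => decide (w ∈ L)) := by
  obtain ⟨p, T, h⟩ := h
  choose σ t hr ht hσ using h
  have h1 : PolyComp O (fun w => σ w 0) := of_dirty ⟨p, T, fun s => ⟨_, _, hr s, ht s, rfl⟩⟩
  have h2 : PolyComp O (fun w => (σ w 0).headD false && (σ w 0).tail.isEmpty) := by fun_prop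
  convert h2 using 2 with w
  rw [Bool.eq_iff_iff, decide_eq_true_iff, hσ]
  rcases σ w 0 with _ | ⟨_ | _, v⟩ <;> simp [List.isEmpty_iff]

theorem mem_PRel {L : Language Bool} {χ : Word → Bool} (h : PolyComp O χ)
    (hL : ∀ w, w ∈ L ↔ χ w = true) : L ∈ PRel O :=
  let ⟨p, T, h⟩ := h
  ⟨p, T, fun s => let ⟨t, ht, hr⟩ := h s; ⟨_, t, hr, ht, by simp [initStore, hL]⟩⟩

end PolyComp

/-! ### Operations on words -/

namespace PolyComp

variable {O : Language Bool} {α β γ : Type} [WordEncoding α] [WordEncoding β] [WordEncoding γ]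

@[fun_prop]
theorem reverse {f : α → Word} (hf : PolyComp O f) : PolyComp O (fun a => (f a).reverse) := by
  convert foldl (init := fun _ => ([] : Word)) (step := fun (s : Word) b => (b :: s : Word)) hf
    (const _) (fun b => by fun_prop) (fun _ => 1) (by simp) (by simp) ⟨1, by simp⟩ using 2 with a
  rw [List.foldl_flip_cons, List.append_nil]

/-- Bounded iteration from the right; see `PolyComp.foldl`. -/
theorem foldr {l : α → Word} {init : α → β} {step : Bool → β → β} (hl : PolyComp O l)
    (hinit : PolyComp O init) (hstep : ∀ b, PolyComp O (step b)) (g : β → ℕ)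
    (hg : ∀ s b, g (step b s) ≤ g s)
    (hlen : ∀ s b, (enc (step b s)).length ≤ (enc s).length + g s)
    (hginit : ∃ q : Polynomial ℕ, ∀ a, g (init a) ≤ q.eval (enc a).length) :
    PolyComp O (fun a => (l a).foldr step (init a)) := by
  convert foldl (step := fun s b => step b s) hl.reverse hinit hstep g hg hlen hginit using 2
  rw [List.foldl_reverse]

@[fun_prop]
theorem append {f g : α → Word} (hf : PolyComp O f) (hg : PolyComp O g) :
    PolyComp O (fun a => f a ++ g a) := by
  convert foldr (step := fun b (s : Word) => (b :: s : Word)) hf hg (fun b => by fun_prop)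
    (fun _ => 1) (by simp) (by simp) ⟨1, by simp⟩ using 2 with a
  induction f a with
  | nil => rfl
  | cons b w ih => exact congrArg (b :: ·) ih

@[fun_prop]
theorem delimit {f : α → Word} (hf : PolyComp O f) : PolyComp O (fun a => delimit (f a)) :=
  (hf.prodMk (const ([] : Word))).of_enc_eq (fun a => a) (fun _ => rfl) (fun a => by simp)

end PolyComp

/-- Equality test for words, by comparing them bit by bit. -/
theorem PolyComp.beq {O : Language Bool} {α : Type} [WordEncoding α] {f g : α → Word}
    (hf : PolyComp O f) (hg : PolyComp O g) : PolyComp O (fun a => f a == g a) := by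
  let step (s : Bool × Word) (b : Bool) : Bool × Word :=
    (s.1 && (!s.2.isEmpty && !(s.2.headD false ^^ b)), s.2.tail)
  have h := foldl (init := fun a => (true, g a)) (step := step) hf (by fun_prop)
    (fun b => by simp only [step]; fun_prop)
    (fun _ => 0) (by simp) (by simp [step]) ⟨0, by simp⟩
  have hstep : ∀ (u v : Word) (c : Bool),
      (let s := u.foldl step (c, v); s.1 && s.2.isEmpty) = (c && (u == v)) := by
    intro u
    induction u with
    | nil => intro v c; cases v <;> simp
    | cons b u ih =>
      intro v c
      rw [List.foldl_cons]
      cases v with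
      | nil => simpa [step] using ih [] false
      | cons b' v =>
        simp only [step, List.isEmpty_cons, Bool.not_false, Bool.true_and, List.headD_cons,
          List.tail_cons, ih, List.cons_beq_cons, Bool.and_assoc]
        cases b <;> cases b' <;> rfl
  convert (comp_fst h).band (comp_snd h).isEmpty using 2 with a
  simpa using (hstep (f a) (g a) true).symm

namespace PolyComp

variable {O : Language Bool} {α β γ : Type} [WordEncoding α] [WordEncoding β] [WordEncoding γ]

/-- The word `0…0` whose length is the value of a polynomial at the length of the input. -/
theorem replicate_eval (p : Polynomial ℕ) :
    PolyComp O (fun w : Word => (List.replicate (p.eval w.length) false : Word)) := by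
  induction p using Polynomial.induction_on with
  | C a => simpa using const _
  | add p q hp hq => simpa only [Polynomial.eval_add, List.replicate_add] using hp.append hq
  | monomial n a ih =>
    have h := foldl (init := fun w : Word =>
        ((List.replicate ((Polynomial.C a * .X ^ n).eval w.length) false : Word), ([] : Word)))
      (step := fun s _ => (s.1, s.1 ++ s.2)) PolyComp.id (ih.prodMk (const _))
      (fun b => by fun_prop) (fun s => s.1.length) (by simp) (by simp; omega)
      ⟨Polynomial.C a * .X ^ n, by simp⟩
    have hfold : ∀ (w : Word) (k m : ℕ),
        w.foldl (fun (s : Word × Word) _ => (s.1, s.1 ++ s.2))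
          (List.replicate k false, List.replicate m false) =
          (List.replicate k false, List.replicate (w.length * k + m) false) := by
      intro w k
      induction w with
      | nil => simp
      | cons b w ih =>
        intro m
        rw [List.foldl_cons, ← List.replicate_add, ih, List.length_cons]
        congr 2
        ring
    convert comp_snd h using 2 with w
    have h0 := hfold w ((Polynomial.C a * Polynomial.X ^ n).eval w.length) 0
    simp only [List.replicate_zero] at h0
    rw [h0]
    simp only [Polynomial.eval_mul, Polynomial.eval_C, Polynomial.eval_X_pow, Nat.add_zero]
    congr 1
    ring

/-- A test for all numbers (in unary) below the length of a word. -/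
theorem forall_lt {l : α → Word} {c : α → β} {test : Word × β → Bool} (hl : PolyComp O l)
    (hc : PolyComp O c) (ht : PolyComp O test) :
    PolyComp O (fun a => decide (∀ k < (l a).length, test (unaryEncodeNat k, c a) = true)) := by
  have h := foldl (init := fun a => (true, ([] : Word), c a))
    (step := fun s _ => (s.1 && test s.2, true :: s.2.1, s.2.2)) hl (by fun_prop)
    (fun b => by fun_prop) (fun _ => 2) (by simp) (by simp; omega) ⟨2, by simp⟩
  have hfold : ∀ (w : Word) (b : Bool) (k : ℕ) (c : β),
      (w.foldl (fun (s : Bool × Word × β) _ => (s.1 && test s.2, true :: s.2.1, s.2.2))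
        (b, unaryEncodeNat k, c)).1 =
        (b && decide (∀ j < w.length, test (unaryEncodeNat (k + j), c) = true)) := by
    intro w
    induction w with
    | nil => simp
    | cons b' w ih =>
      intro b k c
      rw [List.foldl_cons, show true :: unaryEncodeNat k = unaryEncodeNat (k + 1) from rfl, ih]
      rw [Bool.eq_iff_iff]
      simp only [Bool.and_eq_true, decide_eq_true_eq, List.length_cons, and_assoc]
      refine and_congr_right fun _ => ⟨fun h j hj => ?_, fun h => ⟨h 0 (by omega), fun j hj => ?_⟩⟩
      · cases j with
        | zero => exact h.1
        | succ j => rw [← Nat.add_assoc, Nat.add_right_comm]; exact h.2 j (by omega)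
      · rw [Nat.add_right_comm]; exact h (j + 1) (by omega)
  convert comp_fst h using 2 with a
  simpa [unaryEncodeNat] using (hfold (l a) true 0 (c a)).symm

end PolyComp

/-! ### Binary arithmetic -/

/-- The number with binary expansion `w`, least significant bit first, possibly with leading
zeros. -/
def bitsVal : Word → ℕ
  | [] => 0
  | b :: w => b.toNat + 2 * bitsVal w

/-- Prefix a canonical binary expansion with a bit, where zero is the empty word. -/
def consBit (b : Bool) (w : Word) : Word := bif !b && w.isEmpty then [] else b :: w

/-- Remove the leading zeros of a binary expansion. -/
def normBits (w : Word) : Word := w.foldr consBit []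

/-- The recursion that characterizes the canonical binary expansion. -/
theorem encodeNat_bit (b : Bool) (n : ℕ) :
    encodeNat (b.toNat + 2 * n) = consBit b (encodeNat n) := by
  have h : ((b.toNat + 2 * n : ℕ) : Num) = bif b then (n : Num).bit1 else (n : Num).bit0 := by
    cases b
    · rw [cond_false, ← Num.bit0_of_bit0]; push_cast; simp [two_mul]
    · rw [cond_true, ← Num.bit1_of_bit1]; push_cast; simp [two_mul, add_comm]
  rw [encodeNat, h, encodeNat]
  cases (n : Num) <;> cases b <;> try rfl
  · simp only [cond_false, Num.bit0, encodeNum, encodePosNum, consBit]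
    rw [cond_eq_ite, if_neg (by simp [encodePosNum_nonempty])]

theorem normBits_eq (w : Word) : normBits w = encodeNat (bitsVal w) := by
  induction w with
  | nil => rfl
  | cons b w ih => rw [bitsVal, encodeNat_bit, ← ih]; rfl

theorem bitsVal_consBit (b : Bool) (w : Word) :
    bitsVal (consBit b w) = b.toNat + 2 * bitsVal w := by
  cases b <;> cases w <;> simp [consBit, bitsVal]

theorem bitsVal_encodeNat (n : ℕ) : bitsVal (encodeNat n) = n := by
  induction n using Nat.strong_induction_on with
  | _ n ih =>
    rcases Nat.eq_zero_or_pos n with rfl | hn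
    · rfl
    · have h : n = (decide (n % 2 = 1)).toNat + 2 * (n / 2) := by
        rcases Nat.mod_two_eq_zero_or_one n with h | h <;> simp [h] <;> omega
      rw [h, encodeNat_bit, bitsVal_consBit, ih (n / 2) (by omega)]

/-- One column of a binary addition of `s.2.1` and `s.2.2.1` with carry bit `s.1`; the digits of
the result are collected in reverse order in `s.2.2.2`. -/
def addStep (s : Bool × Word × Word × Word) (_ : Bool) : Bool × Word × Word × Word :=
  let a := s.2.1.headD false
  let b := s.2.2.1.headD false
  (a && b || s.1 && (a ^^ b), s.2.1.tail, s.2.2.1.tail, (a ^^ b ^^ s.1) :: s.2.2.2)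

/-- One column of a binary subtraction, with borrow bit `s.1`; compare `addStep`. -/
def subStep (s : Bool × Word × Word × Word) (_ : Bool) : Bool × Word × Word × Word :=
  let a := s.2.1.headD false
  let b := s.2.2.1.headD false
  (!a && b || s.1 && !(a ^^ b), s.2.1.tail, s.2.2.1.tail, (a ^^ b ^^ s.1) :: s.2.2.2)

/-- Binary addition. -/
def addBits (u v : Word) : Word :=
  ((u ++ v ++ [false]).foldl addStep (false, u, v, [])).2.2.2.reverse

/-- Binary subtraction, with value `0` if the result would be negative. -/
def subBits (u v : Word) : Word :=
  let s := (u ++ v).foldl subStep (false, u, v, [])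
  bif s.1 then [] else s.2.2.2.reverse

/-- Binary multiplication, by the method of Horner. -/
def mulBits (u v : Word) : Word :=
  u.foldr (fun b acc => addBits (bif b then v else []) (false :: acc)) []

theorem bitsVal_headD_tail (w : Word) :
    bitsVal w = (w.headD false).toNat + 2 * bitsVal w.tail := by
  cases w <;> simp [bitsVal]

theorem bitsVal_append (u v : Word) :
    bitsVal (u ++ v) = bitsVal u + 2 ^ u.length * bitsVal v := by
  induction u with
  | nil => simp [bitsVal]
  | cons b u ih => simp only [List.cons_append, bitsVal, ih, List.length_cons, pow_succ]; ring

theorem bitsVal_lt (w : Word) : bitsVal w < 2 ^ w.length := by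
  induction w with
  | nil => simp [bitsVal]
  | cons b w ih =>
    rw [bitsVal, List.length_cons, pow_succ]
    cases b <;> simp <;> omega

/-- Invariant of binary addition: the digits produced so far, together with the carry and the
remaining digits of the summands shifted by the number of columns, represent the sum. -/
theorem foldl_addStep (w : Word) : ∀ (c : Bool) (u v r : Word),
    let s := w.foldl addStep (c, u, v, r)
    s.2.1 = u.drop w.length ∧ s.2.2.1 = v.drop w.length ∧
    s.2.2.2.length = r.length + w.length ∧
    bitsVal s.2.2.2.reverse + 2 ^ (r.length + w.length) * (s.1.toNat + bitsVal (u.drop w.length)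
      + bitsVal (v.drop w.length)) =
      bitsVal r.reverse + 2 ^ r.length * (c.toNat + bitsVal u + bitsVal v) := by
  induction w with
  | nil => intro c u v r; simp
  | cons b w ih =>
    intro c u v r
    obtain ⟨h1, h2, h3, h4⟩ := ih (u.headD false && v.headD false ||
      c && (u.headD false ^^ v.headD false)) u.tail v.tail
      ((u.headD false ^^ v.headD false ^^ c) :: r)
    have hd : ∀ x : Word, x.tail.drop w.length = x.drop (w.length + 1) := fun x => by
      cases x <;> simp
    simp only [hd, List.length_cons, List.reverse_cons] at h1 h2 h3 h4
    rw [bitsVal_append, List.length_reverse] at h4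
    rw [List.foldl_cons]
    refine ⟨h1, h2, h3.trans (by simp only [List.length_cons]; omega), ?_⟩
    rw [List.length_cons, show r.length + (w.length + 1) = r.length + 1 + w.length by ring]
    refine h4.trans ?_
    rw [bitsVal_headD_tail u, bitsVal_headD_tail v, pow_succ]
    cases u.headD false <;> cases v.headD false <;> cases c <;> simp [bitsVal] <;> ring

theorem bitsVal_addBits (u v : Word) : bitsVal (addBits u v) = bitsVal u + bitsVal v := by
  obtain ⟨h1, h2, h3, h4⟩ := foldl_addStep (u ++ v ++ [false]) false u v []
  set w := u ++ v ++ [false] with hw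
  have hlen : w.length = u.length + v.length + 1 := by simp [hw, Nat.add_assoc]
  rw [List.drop_eq_nil_of_le (by omega), List.drop_eq_nil_of_le (by omega)] at h4
  simp only [bitsVal, List.length_nil, Nat.zero_add, List.reverse_nil, pow_zero, one_mul,
    Bool.toNat_false, Nat.add_zero] at h4
  -- The number of columns leaves no room for a final carry.
  have hu := bitsVal_lt u
  have hv := bitsVal_lt v
  have hu' : 2 ^ u.length ≤ 2 ^ (u.length + v.length) := Nat.pow_le_pow_right two_pos (by omega)
  have hv' : 2 ^ v.length ≤ 2 ^ (u.length + v.length) := Nat.pow_le_pow_right two_pos (by omega)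
  have hw' : 2 ^ w.length = 2 * 2 ^ (u.length + v.length) := by rw [hlen, pow_succ, mul_comm]
  rw [← h4, addBits, ← hw]
  cases hc : (w.foldl addStep (false, u, v, [])).1 with
  | false => simp
  | true => rw [hc, Bool.toNat_true, mul_one] at h4; omega

/-- Invariant of binary subtraction; compare `foldl_addStep`. -/
theorem foldl_subStep (w : Word) : ∀ (c : Bool) (u v r : Word),
    let s := w.foldl subStep (c, u, v, r)
    s.2.2.2.length = r.length + w.length ∧
    (bitsVal s.2.2.2.reverse : ℤ) + 2 ^ (r.length + w.length) * (bitsVal (u.drop w.length)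
      - bitsVal (v.drop w.length) - s.1.toNat) =
      bitsVal r.reverse + 2 ^ r.length * (bitsVal u - bitsVal v - c.toNat) := by
  induction w with
  | nil => intro c u v r; simp
  | cons b w ih =>
    intro c u v r
    obtain ⟨h3, h4⟩ := ih (!u.headD false && v.headD false ||
      c && !(u.headD false ^^ v.headD false)) u.tail v.tail
      ((u.headD false ^^ v.headD false ^^ c) :: r)
    have hd : ∀ x : Word, x.tail.drop w.length = x.drop (w.length + 1) := fun x => by
      cases x <;> simp
    simp only [hd, List.length_cons, List.reverse_cons] at h3 h4
    rw [bitsVal_append, List.length_reverse] at h4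
    rw [List.foldl_cons]
    refine ⟨h3.trans (by simp only [List.length_cons]; omega), ?_⟩
    rw [List.length_cons, show r.length + (w.length + 1) = r.length + 1 + w.length by ring]
    refine h4.trans ?_
    rw [bitsVal_headD_tail u, bitsVal_headD_tail v, pow_succ]
    cases u.headD false <;> cases v.headD false <;> cases c <;> simp [bitsVal] <;> ring

theorem bitsVal_subBits (u v : Word) : bitsVal (subBits u v) = bitsVal u - bitsVal v := by
  obtain ⟨h3, h4⟩ := foldl_subStep (u ++ v) false u v []
  rw [List.drop_eq_nil_of_le (by simp), List.drop_eq_nil_of_le (by simp)] at h4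
  set s := (u ++ v).foldl subStep (false, u, v, []) with hs
  have hlt := bitsVal_lt s.2.2.2.reverse
  rw [List.length_reverse, h3, List.length_nil, Nat.zero_add, List.length_append] at hlt
  simp only [bitsVal, List.length_nil, List.length_append, List.reverse_nil, pow_zero, one_mul,
    Bool.toNat_false, Nat.cast_zero, sub_zero, sub_self, zero_sub, zero_add] at h4
  have hdef : subBits u v = bif s.1 then [] else s.2.2.2.reverse := rfl
  rw [hdef]
  cases hc : s.1 with
  | false =>
    rw [hc] at h4
    simp at h4 ⊢
    omega
  | true =>
    rw [hc] at h4
    zify at hlt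
    simp at h4 ⊢
    simp [bitsVal]
    omega

theorem length_addBits (u v : Word) : (addBits u v).length = u.length + v.length + 1 := by
  obtain ⟨-, -, h, -⟩ := foldl_addStep (u ++ v ++ [false]) false u v []
  simpa [addBits, ← Nat.add_assoc] using h

theorem bitsVal_mulBits (u v : Word) : bitsVal (mulBits u v) = bitsVal u * bitsVal v := by
  induction u with
  | nil => simp [mulBits, bitsVal]
  | cons b u ih =>
    have : mulBits (b :: u) v = addBits (bif b then v else []) (false :: mulBits u v) := rfl
    rw [this, bitsVal_addBits, bitsVal, bitsVal, ih]
    cases b <;> simp [bitsVal] <;> ring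

namespace PolyComp

variable {O : Language Bool} {α : Type} [WordEncoding α]

@[fun_prop]
theorem normBits {f : α → Word} (hf : PolyComp O f) : PolyComp O (fun a => normBits (f a)) := by
  refine foldr hf (const _) (fun b => ?_) (fun _ => 1) (by simp) ?_ ⟨1, by simp⟩
  · unfold consBit
    fun_prop
  · intro s b
    cases b <;> cases s <;> simp [consBit]

@[fun_prop]
theorem addBits {f g : α → Word} (hf : PolyComp O f) (hg : PolyComp O g) :
    PolyComp O (fun a => addBits (f a) (g a)) := by
  have h := foldl (l := fun a => f a ++ g a ++ [false])
    (init := fun a => (false, f a, g a, ([] : Word))) (step := addStep) (by fun_prop)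
    (by fun_prop) (fun b => by unfold addStep; fun_prop) (fun _ => 1) (by simp)
    (by simp [addStep]; omega) ⟨1, by simp⟩
  unfold _root_.addBits
  fun_prop

@[fun_prop]
theorem subBits {f g : α → Word} (hf : PolyComp O f) (hg : PolyComp O g) :
    PolyComp O (fun a => subBits (f a) (g a)) := by
  have h := foldl (l := fun a => f a ++ g a)
    (init := fun a => (false, f a, g a, ([] : Word))) (step := subStep) (by fun_prop)
    (by fun_prop) (fun b => by unfold subStep; fun_prop) (fun _ => 1) (by simp)
    (by simp [subStep]; omega) ⟨1, by simp⟩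
  unfold _root_.subBits
  fun_prop

@[fun_prop]
theorem mulBits {f g : α → Word} (hf : PolyComp O f) (hg : PolyComp O g) :
    PolyComp O (fun a => mulBits (f a) (g a)) := by
  obtain ⟨q, hq⟩ := hg.length_bound
  have h := foldr (init := fun a => (g a, ([] : Word)))
    (step := fun b s => (s.1, _root_.addBits (bif b then s.1 else []) (false :: s.2))) hf
    (by fun_prop) (fun b => by fun_prop) (fun s => s.1.length + 2) (by simp) (by
      intro s b
      cases b <;> simp [length_addBits] <;> omega)
    ⟨q + 2, fun a => by simpa using hq a⟩
  convert comp_snd h using 2 with a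
  have : ∀ u v : Word, u.foldr (fun b (s : Word × Word) =>
      (s.1, _root_.addBits (bif b then s.1 else []) (false :: s.2))) (v, []) =
      (v, _root_.mulBits u v) := by
    intro u v
    induction u with
    | nil => rfl
    | cons b u ih => rw [List.foldr_cons, ih]; rfl
  rw [this]

end PolyComp

/-! ### Tuples and fractions -/

theorem encTuple_nil : encTuple [] = [] := rfl

theorem encTuple_cons (w : Word) (ws : List Word) :
    encTuple (w :: ws) = delimit w ++ encTuple ws := rfl

theorem encTuple_injective : Function.Injective encTuple := by
  intro l
  induction l with
  | nil =>
    intro l' h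
    cases l' with
    | nil => rfl
    | cons w ws =>
      have := congrArg List.length h
      simp [encTuple_nil, encTuple_cons] at this
      omega
  | cons w ws ih =>
    intro l' h
    cases l' with
    | nil =>
      have := congrArg List.length h
      simp [encTuple_nil, encTuple_cons] at this
    | cons w' ws' =>
      have := congrArg undelimit h
      rw [encTuple_cons, encTuple_cons, undelimit_delimit_append, undelimit_delimit_append,
        Prod.mk.injEq] at this
      rw [this.1, ih this.2]

/-- The component with index `n` of an encoded tuple. -/
def entry : ℕ → Word → Word
  | 0, s => (undelimit s).1
  | n + 1, s => entry n (undelimit s).2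

@[simp] theorem entry_zero (w : Word) (ws : List Word) : entry 0 (encTuple (w :: ws)) = w := by
  rw [encTuple_cons, entry, undelimit_delimit_append]

@[simp] theorem entry_succ (n : ℕ) (w : Word) (ws : List Word) :
    entry (n + 1) (encTuple (w :: ws)) = entry n (encTuple ws) := by
  rw [encTuple_cons, entry, undelimit_delimit_append]

@[fun_prop]
theorem PolyComp.entry {O : Language Bool} {α : Type} [WordEncoding α] {f : α → Word} (n : ℕ)
    (hf : PolyComp O f) : PolyComp O (fun a => entry n (f a)) := by
  induction n generalizing f with
  | zero => unfold _root_.entry; fun_prop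
  | succ n ih => exact ih (comp_snd (undelimit hf))

theorem encodeNat_injective : Function.Injective encodeNat :=
  Function.LeftInverse.injective decode_encodeNat

theorem encInt_injective : Function.Injective encInt := by
  intro a b h
  rw [encInt, encInt, List.cons.injEq] at h
  have h1 := encodeNat_injective h.2
  have h2 : a < 0 ↔ b < 0 := by simpa using h.1
  omega

theorem encFrac_injective : Function.Injective encFrac := by
  intro a b h
  have := encTuple_injective h
  simp only [List.cons.injEq, and_true] at this
  exact Prod.ext (encInt_injective this.1) (PNat.eq (encodeNat_injective this.2))

theorem encVec_injective (n : ℕ) : Function.Injective (encVec (n := n)) := by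
  intro x y h
  have := List.ofFn_injective (encTuple_injective h)
  funext j
  exact encFrac_injective (congrFun this j)

theorem encodeNat_eq_nil {n : ℕ} : encodeNat n = [] ↔ n = 0 :=
  encodeNat_injective.eq_iff' rfl

/-- The integer with sign bit and binary absolute value `w`. -/
def intVal (w : Word) : ℤ :=
  bif w.headD false then -(bitsVal w.tail : ℤ) else bitsVal w.tail

theorem intVal_encInt (z : ℤ) : intVal (encInt z) = z := by
  simp only [intVal, encInt, List.headD_cons, List.tail_cons, bitsVal_encodeNat]
  by_cases h : z < 0
  · simp [h, abs_of_neg h]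
  · simp [h, abs_of_nonneg (not_lt.mp h)]

/-- The encoding of the difference of two natural numbers. -/
def intDiff (u v : Word) : Word :=
  bif (normBits (subBits v u)).isEmpty then false :: normBits (subBits u v)
  else true :: normBits (subBits v u)

theorem intDiff_eq (u v : Word) : intDiff u v = encInt (bitsVal u - bitsVal v) := by
  have hdec : (normBits (subBits v u)).isEmpty = decide (bitsVal v ≤ bitsVal u) := by
    rw [Bool.eq_iff_iff, List.isEmpty_iff, normBits_eq, encodeNat_eq_nil, bitsVal_subBits]
    simp; omega
  rw [intDiff, hdec, encInt, normBits_eq, normBits_eq, bitsVal_subBits, bitsVal_subBits]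
  by_cases h : bitsVal v ≤ bitsVal u
  · rw [decide_eq_true h, cond_true, decide_eq_false (by omega)]
    congr 2; omega
  · rw [decide_eq_false h, cond_false, decide_eq_true (by omega)]
    congr 2; omega

/-- The sum of two fractions, without reduction. -/
def Frac.add (q r : Frac) : Frac := (q.1 * ((r.2 : ℕ) : ℤ) + r.1 * ((q.2 : ℕ) : ℤ), q.2 * r.2)

/-- The negative of a fraction. -/
def Frac.neg (q : Frac) : Frac := (-q.1, q.2)

theorem Frac.val_add (q r : Frac) : (q.add r).val = q.val + r.val := by
  have hq : ((q.2 : ℕ) : ℝ) ≠ 0 := by simp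
  have hr : ((r.2 : ℕ) : ℝ) ≠ 0 := by simp
  simp only [Frac.val, Frac.add, PNat.mul_coe]
  push_cast
  field_simp

theorem Frac.val_neg (q : Frac) : q.neg.val = -q.val := by
  simp [Frac.val, Frac.neg, neg_div]

/-- Addition of encoded fractions. -/
def fracAdd (r s : Word) : Word :=
  let σ := (entry 0 r).headD false
  let τ := (entry 0 s).headD false
  let a := mulBits (entry 0 r).tail (entry 1 s)
  let b := mulBits (entry 0 s).tail (entry 1 r)
  encTuple [
    intDiff (addBits (bif σ then [] else a) (bif τ then [] else b))
      (addBits (bif σ then a else []) (bif τ then b else [])),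
    normBits (mulBits (entry 1 r) (entry 1 s))]

theorem fracAdd_eq (r s : Word) : fracAdd r s =
    encTuple [encInt (intVal (entry 0 r) * bitsVal (entry 1 s) +
      intVal (entry 0 s) * bitsVal (entry 1 r)),
      encodeNat (bitsVal (entry 1 r) * bitsVal (entry 1 s))] := by
  simp only [fracAdd, intDiff_eq, normBits_eq, bitsVal_mulBits, bitsVal_addBits, intVal]
  congr 3
  cases (entry 0 r).headD false <;> cases (entry 0 s).headD false <;>
    simp [bitsVal, bitsVal_mulBits] <;> ring

theorem fracAdd_encFrac (q r : Frac) : fracAdd (encFrac q) (encFrac r) = encFrac (q.add r) := by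
  rw [fracAdd_eq]
  simp only [encFrac, entry_zero, entry_succ, intVal_encInt, bitsVal_encodeNat, Frac.add,
    PNat.mul_coe]

/-- Negation of encoded fractions; the sign of zero is not changed. -/
def fracNeg (r : Word) : Word :=
  encTuple [bif (entry 0 r).tail.isEmpty then entry 0 r
    else (!(entry 0 r).headD false) :: (entry 0 r).tail, entry 1 r]

theorem fracNeg_encFrac (q : Frac) : fracNeg (encFrac q) = encFrac q.neg := by
  simp only [fracNeg, encFrac, entry_zero, entry_succ, Frac.neg]
  congr 2
  simp only [encInt, List.tail_cons, List.headD_cons, Int.natAbs_neg]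
  rcases eq_or_ne q.1 0 with h | h
  · rw [h]; rfl
  · have : (encodeNat q.1.natAbs).isEmpty = false := by
      rw [← Bool.not_eq_true, List.isEmpty_iff, encodeNat_eq_nil]; omega
    rw [this, cond_false]
    congr 1
    rw [Bool.eq_iff_iff]
    simp
    omega

/-- Sign test for encoded fractions. -/
def fracNonpos (r : Word) : Bool := (entry 0 r).headD false || (entry 0 r).tail.isEmpty

theorem fracNonpos_encFrac (q : Frac) : fracNonpos (encFrac q) = true ↔ q.val ≤ 0 := by
  have hq : (0 : ℝ) < ((q.2 : ℕ) : ℝ) := by exact_mod_cast q.2.pos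
  rw [Frac.val, div_le_iff₀ hq, zero_mul]
  simp only [fracNonpos, encFrac, entry_zero, encInt, List.headD_cons, List.tail_cons,
    Bool.or_eq_true, decide_eq_true_eq, List.isEmpty_iff, encodeNat_eq_nil]
  norm_cast
  omega

/-- Comparison of encoded fractions. -/
def fracLE (r s : Word) : Bool := fracNonpos (fracAdd r (fracNeg s))

theorem fracLE_encFrac (q r : Frac) : fracLE (encFrac q) (encFrac r) = true ↔ q.val ≤ r.val := by
  rw [fracLE, fracNeg_encFrac, fracAdd_encFrac, fracNonpos_encFrac, Frac.val_add, Frac.val_neg,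
    add_neg_le_iff_le_add, zero_add]

/-- Recognition of the encodings of fractions: adding zero restores the canonical form. -/
def isFrac (g : Word) : Bool := fracAdd g (encFrac (0, 1)) == g && !(entry 1 g).isEmpty

theorem isFrac_iff (g : Word) : isFrac g = true ↔ ∃ γ : Frac, g = encFrac γ := by
  constructor
  · intro h
    simp only [isFrac, Bool.and_eq_true, beq_iff_eq, Bool.not_eq_true', ← Bool.not_eq_true,
      List.isEmpty_iff] at h
    obtain ⟨h1, h2⟩ := h
    rw [← h1]
    rw [← h1, fracAdd_eq, entry_succ, entry_zero, encodeNat_eq_nil] at h2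
    exact ⟨(_, ⟨_, Nat.pos_of_ne_zero h2⟩), by rw [fracAdd_eq]; rfl⟩
  · rintro ⟨γ, rfl⟩
    simp only [isFrac, Bool.and_eq_true, beq_iff_eq, Bool.not_eq_true', ← Bool.not_eq_true,
      List.isEmpty_iff]
    constructor
    · rw [fracAdd_encFrac]
      congr 1
      simp [Frac.add]
    · simp [encFrac, encodeNat_eq_nil]

/-- The fraction `-2 ^ (-k)`, where `k` is the length of `w = 0…0`. -/
def fracNegPow (w : Word) : Word := encTuple [[true, true], w ++ [true]]

theorem fracNegPow_replicate (k : ℕ) :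
    fracNegPow (List.replicate k false) = encFrac (-1, 2 ^ k) := by
  have h : ∀ k, encodeNat (2 ^ k) = List.replicate k false ++ [true] := by
    intro k
    induction k with
    | zero => rfl
    | succ k ih =>
      have := encodeNat_bit false (2 ^ k)
      rw [Bool.toNat_false, zero_add, ← pow_succ', ih] at this
      rw [this, consBit]
      have hne : (List.replicate k false ++ [true]).isEmpty = false := by
        rw [← Bool.not_eq_true, List.isEmpty_iff]; simp
      rw [hne]
      rfl
  rw [fracNegPow, encFrac, ← h]
  simp only [PNat.pow_coe]
  rfl

theorem Frac.val_neg_one_two_pow (k : ℕ) : Frac.val (-1, 2 ^ k) = -(1 / 2) ^ k := by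
  simp [Frac.val, neg_div]

/-- The encoding of the zero vector with as many coordinates as the given encoded vector. -/
def zeroLike (s : Word) : Word :=
  (s.foldl (fun (t : Word × Word) _ =>
    ((undelimit t.1).2, bif t.1.isEmpty then t.2 else delimit (encFrac (0, 1)) ++ t.2)) (s, [])).2

theorem zeroLike_encVec {n : ℕ} (x : FracVec n) :
    zeroLike (encVec x) = encVec fun _ : Fin n => (0, 1) := by
  have hfold : ∀ (w : Word) (l : List Word) (m : ℕ), l.length ≤ w.length →
      (w.foldl (fun (t : Word × Word) _ => ((undelimit t.1).2,
        bif t.1.isEmpty then t.2 else delimit (encFrac (0, 1)) ++ t.2))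
        (encTuple l, encTuple (List.replicate m (encFrac (0, 1))))).2 =
      encTuple (List.replicate (l.length + m) (encFrac (0, 1))) := by
    intro w
    induction w with
    | nil =>
      intro l m h
      cases l with
      | nil => simp
      | cons => simp at h
    | cons b w ih =>
      intro l m h
      rw [List.foldl_cons]
      cases l with
      | nil => exact ih [] m (by simp)
      | cons u l =>
        have hne : (encTuple (u :: l)).isEmpty = false := by
          rw [← Bool.not_eq_true, List.isEmpty_iff, ← List.length_eq_zero_iff, encTuple_cons,
            List.length_append, length_delimit]
          omega
        simp only [hne, cond_false]
        rw [encTuple_cons, undelimit_delimit_append, ← encTuple_cons, ← List.replicate_succ,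
          ih l (m + 1) (by simpa using h), List.length_cons]
        congr 2
        omega
  have hle : ∀ l : List Word, l.length ≤ (encTuple l).length := by
    intro l
    induction l with
    | nil => simp
    | cons u l ih => rw [encTuple_cons]; simp; omega
  have := hfold (encVec x) (List.ofFn fun j => encFrac (x j)) 0 (hle _)
  rw [List.length_ofFn, Nat.add_zero] at this
  have hzero : (encVec fun _ : Fin n => ((0, 1) : Frac)) =
      encTuple (List.replicate n (encFrac (0, 1))) := congrArg encTuple (List.ofFn_const _ _)
  rw [hzero, ← this]
  rfl

namespace PolyComp

variable {O : Language Bool} {α : Type} [WordEncoding α] {f g : α → Word}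

@[fun_prop]
theorem fracAdd (hf : PolyComp O f) (hg : PolyComp O g) :
    PolyComp O (fun a => fracAdd (f a) (g a)) := by
  simp only [_root_.fracAdd, intDiff, encTuple_cons, encTuple_nil]
  fun_prop

@[fun_prop]
theorem fracNeg (hf : PolyComp O f) : PolyComp O (fun a => fracNeg (f a)) := by
  simp only [_root_.fracNeg, encTuple_cons, encTuple_nil]
  fun_prop

@[fun_prop]
theorem fracNonpos (hf : PolyComp O f) : PolyComp O (fun a => fracNonpos (f a)) := by
  unfold _root_.fracNonpos
  fun_prop

@[fun_prop]
theorem fracLE (hf : PolyComp O f) (hg : PolyComp O g) :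
    PolyComp O (fun a => fracLE (f a) (g a)) := by
  unfold _root_.fracLE
  fun_prop

@[fun_prop]
theorem isFrac (hf : PolyComp O f) : PolyComp O (fun a => isFrac (f a)) :=
  (beq (fracAdd hf (const _)) hf).band (by fun_prop)

@[fun_prop]
theorem fracNegPow (hf : PolyComp O f) : PolyComp O (fun a => fracNegPow (f a)) := by
  simp only [_root_.fracNegPow, encTuple_cons, encTuple_nil]
  fun_prop

@[fun_prop]
theorem zeroLike (hf : PolyComp O f) : PolyComp O (fun a => zeroLike (f a)) := by
  refine comp_snd (foldl hf (hf.prodMk (const _)) (fun b => by fun_prop)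
    (fun _ => (_root_.delimit (encFrac (0, 1))).length) (by simp) (fun s b => ?_)
    ⟨Polynomial.C (_root_.delimit (encFrac (0, 1))).length, by simp⟩)
  have := length_undelimit s.1
  cases s.1.isEmpty <;> simp <;> omega

/-- The test whether the length of one word is at most that of another one. -/
theorem length_le (hf : PolyComp O f) (hg : PolyComp O g) :
    PolyComp O (fun a => decide ((f a).length ≤ (g a).length)) := by
  have h := foldl (step := fun (s : Word) _ => (s.tail : Word)) hg hf (fun b => by fun_prop)
    (fun _ => 0) (by simp) (by simp) ⟨0, by simp⟩
  convert h.isEmpty using 2 with a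
  have : ∀ u v : Word, u.foldl (fun (s : Word) _ => s.tail) v = v.drop u.length := by
    intro u
    induction u with
    | nil => simp
    | cons b u ih => intro v; rw [List.foldl_cons, ih]; cases v <;> simp
  rw [this, Bool.eq_iff_iff]
  simp [List.isEmpty_iff]

end PolyComp

/-! ### Oracles and certificates -/

/-- The disjoint union of two languages, tagged by the first bit. -/
def taggedUnion (L₁ L₂ : Language Bool) : Language Bool :=
  {s | (s.headD false = true ∧ s.tail ∈ L₁) ∨ (s ≠ [] ∧ s.headD false = false ∧ s.tail ∈ L₂)}

theorem true_cons_mem_taggedUnion {L₁ L₂ : Language Bool} {w : Word} :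
    true :: w ∈ taggedUnion L₁ L₂ ↔ w ∈ L₁ := by
  change (_ ∨ _) ↔ _; simp

theorem false_cons_mem_taggedUnion {L₁ L₂ : Language Bool} {w : Word} :
    false :: w ∈ taggedUnion L₁ L₂ ↔ w ∈ L₂ := by
  change (_ ∨ _) ↔ _; simp

open Classical in
theorem taggedUnion_mem_NPRel {O L₁ L₂ : Language Bool} (h₁ : L₁ ∈ NPRel O) (h₂ : L₂ ∈ NPRel O) :
    taggedUnion L₁ L₂ ∈ NPRel O := by
  obtain ⟨V₁, hV₁, p₁, h₁⟩ := h₁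
  obtain ⟨V₂, hV₂, p₂, h₂⟩ := h₂
  have hV₁ := PolyComp.of_mem_PRel hV₁
  have hV₂ := PolyComp.of_mem_PRel hV₂
  -- The verifier checks the length of the certificate, as the bounds `p₁` and `p₂` may differ.
  let check (V : Language Bool) (p : Polynomial ℕ) (s c : Word) : Bool :=
    decide (c.length ≤ (List.replicate (p.eval s.length) false).length) &&
      decide (encTuple [s, c] ∈ V)
  have hcheck : ∀ V p, PolyComp O (fun w : Word => decide (w ∈ V)) →
      PolyComp O (fun w : Word => check V p (entry 0 w).tail (entry 1 w)) := by
    intro V p hV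
    refine (PolyComp.length_le (PolyComp.entry 1 .id)
      ((PolyComp.replicate_eval p).comp (f := fun w : Word => ((entry 0 w).tail : Word))
        (by fun_prop))).band (hV.comp ?_)
    simp only [encTuple_cons, encTuple_nil]
    fun_prop
  have hc₁ := hcheck V₁ p₁ hV₁
  have hc₂ := hcheck V₂ p₂ hV₂
  let χ (w : Word) : Bool :=
    bif (entry 0 w).headD false then check V₁ p₁ (entry 0 w).tail (entry 1 w)
    else !(entry 0 w).isEmpty && check V₂ p₂ (entry 0 w).tail (entry 1 w)
  have hχ : PolyComp O χ :=
    PolyComp.cond (by fun_prop) hc₁ (PolyComp.band (by fun_prop) hc₂)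
  refine ⟨{w | χ w = true}, PolyComp.mem_PRel hχ fun w => Iff.rfl, p₁ + p₂, fun s => ?_⟩
  change (_ ∨ _) ↔ ∃ c : Word, _ ∧ χ _ = true
  simp only [χ, entry_zero, entry_succ, Polynomial.eval_add, h₁, h₂]
  have hp₁ := p₁.eval_le_eval_of_le (show s.tail.length ≤ s.length by simp)
  have hp₂ := p₂.eval_le_eval_of_le (show s.tail.length ≤ s.length by simp)
  rcases s with _ | ⟨_ | _, s⟩
  · simp
  · simp only [List.headD_cons, List.tail_cons, check, List.length_replicate] at hp₂ ⊢
    simp only [Bool.false_eq_true, false_and, false_or, ne_eq, reduceCtorEq, not_false_eq_true,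
      true_and, cond_false, List.isEmpty_cons, Bool.not_false, Bool.true_and, Bool.and_eq_true,
      decide_eq_true_eq]
    exact exists_congr fun c => ⟨fun h => ⟨by omega, h⟩, fun h => h.2⟩
  · simp only [List.headD_cons, List.tail_cons, check, List.length_replicate] at hp₁ ⊢
    simp only [true_and, ne_eq, Bool.true_eq_false, false_and, and_false, or_false, cond_true,
      Bool.and_eq_true, decide_eq_true_eq]
    exact exists_congr fun c => ⟨fun h => ⟨by omega, h⟩, fun h => h.2⟩

/-! ### Verification of bilevel solutions -/

theorem length_unaryEncodeNat (n : ℕ) : (unaryEncodeNat n).length = n :=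
  unary_decode_encode_nat n

namespace BilevelProblem

variable {P : BilevelProblem}

/-- The language of the encodings of rational upper-level decisions with a rational feasible
lower-level decision. -/
def lowerFeasibleLanguage (P : BilevelProblem) : Language Bool :=
  {s | ∃ (i : Word) (x : FracVec (P.nx i)) (y : FracVec (P.ny i)),
    s = encTuple [i, encVec x, encVec y] ∧ x.val ∈ P.X i ∧ y.val ∈ P.lowerFeasible i x.val}

/-- The language of the encodings of rational upper-level decisions. -/
def upperDomainLanguage (P : BilevelProblem) : Language Bool :=
  {s | ∃ (i : Word) (x : FracVec (P.nx i)), s = encTuple [i, encVec x] ∧ x.val ∈ P.X i}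

theorem mem_upperDomainLanguage {i : Word} {x : FracVec (P.nx i)} :
    encTuple [i, encVec x] ∈ P.upperDomainLanguage ↔ x.val ∈ P.X i := by
  constructor
  · rintro ⟨i', x', h, hx⟩
    have h := encTuple_injective h
    simp only [List.cons.injEq, and_true] at h
    obtain ⟨rfl, h⟩ := h
    rwa [encVec_injective _ h]
  · exact fun hx => ⟨i, x, rfl, hx⟩

theorem mem_lowerDecision {i : Word} {x : FracVec (P.nx i)} {γ : Frac} :
    encTuple [i, encVec x, encFrac γ] ∈ P.lowerDecision ↔
      x.val ∈ P.X i ∧ AttainsBound (P.lowerFeasible i x.val) (P.f i x.val) γ.val := by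
  constructor
  · rintro ⟨i', x', γ', h, hx⟩
    have h := encTuple_injective h
    simp only [List.cons.injEq, and_true] at h
    obtain ⟨rfl, h, h'⟩ := h
    rwa [encVec_injective _ h, encFrac_injective h']
  · exact fun hx => ⟨i, x, γ, rfl, hx⟩

theorem mem_starDecision {h : P.ObjectiveFamily} {i : Word} {x : FracVec (P.nx i)} {w : Word}
    {a : FracVec (P.ny i)} {b c γ : Frac} :
    encTuple [i, encVec x, w, encVec a, encFrac b, encFrac c, encFrac γ] ∈ P.starDecision h ↔
      h.dom i x.val w ∧ AttainsBound (P.epigraphWith i x.val a.val b.val c.val)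
        (fun q => h.fn i x.val w q.1) γ.val := by
  constructor
  · rintro ⟨i', x', w', a', b', c', γ', h, hx⟩
    have h := encTuple_injective h
    simp only [List.cons.injEq, and_true] at h
    obtain ⟨rfl, h1, rfl, h2, h3, h4, h5⟩ := h
    rwa [encVec_injective _ h1, encVec_injective _ h2, encFrac_injective h3, encFrac_injective h4,
      encFrac_injective h5]
  · exact fun hx => ⟨i, x, w, a, b, c, γ, rfl, hx⟩

open Classical in
/-- If membership of rational points in the sets `S i` is decidable in polynomial time with an
oracle `A` and solutions have polynomial size, then a solution is a certificate for the problem of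
optimizing over `S i`. -/
theorem upperDecision_mem_NPRel {A : Language Bool} {δ : Word → ℝ} (hP : P.PolyPresented δ)
    {S : ∀ i, Set ((Fin (P.nx i) → ℝ) × (Fin (P.ny i) → ℝ))} {χ : Word → Bool}
    (hχ : PolyComp A χ) (hS : ∀ i, S i ⊆ P.canonicalFeasible i)
    (hχS : ∀ (i : Word) (x : FracVec (P.nx i)) (v : FracVec (P.ny i)), x.val ∈ P.X i →
      v.val ∈ P.lowerFeasible i x.val →
      (χ (encTuple [i, encVec x, encVec v]) = true ↔ (x.val, v.val) ∈ S i))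
    (hsmall : P.SmallSolutions S) : P.upperDecision S ∈ NPRel A := by
  obtain ⟨p, hp⟩ := hsmall
  obtain ⟨φ, hφ, hφF⟩ := hP.F_computable
  have hφ : PolyComp A φ := (PolyComp.of_dirty hφ).mono_zero
  have hlow : PolyComp A (fun w : Word => decide (w ∈ P.lowerFeasibleLanguage)) :=
    (PolyComp.of_mem_PRel hP.lower_decidable).mono_zero
  let sol (w : Word) : Word := encTuple [entry 0 (entry 0 w), entry 0 (entry 1 w),
    entry 1 (entry 1 w)]
  have hsol : PolyComp A sol := by
    simp only [sol, encTuple_cons, encTuple_nil]; fun_prop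
  have hinst : PolyComp A (fun w : Word =>
      encTuple [entry 0 (entry 0 w), entry 1 (entry 0 w)]) := by
    simp only [encTuple_cons, encTuple_nil]; fun_prop
  let V (w : Word) : Bool :=
    (entry 0 w == encTuple [entry 0 (entry 0 w), entry 1 (entry 0 w)]) &&
    (isFrac (entry 1 (entry 0 w)) && (decide (sol w ∈ P.lowerFeasibleLanguage) &&
      (χ (sol w) && fracLE (φ (sol w)) (entry 1 (entry 0 w)))))
  have hV : PolyComp A V := by
    refine (PolyComp.beq (by fun_prop) hinst).band (PolyComp.band (by fun_prop)
      ((hlow.comp hsol).band ((hχ.comp hsol).band ((hφ.comp hsol).fracLE (by fun_prop)))))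
  refine ⟨{w | V w = true}, PolyComp.mem_PRel hV fun w => Iff.rfl, p, fun s => ?_⟩
  change _ ↔ ∃ c : Word, _ ∧ V _ = true
  simp only [V, sol, entry_zero, entry_succ, Bool.and_eq_true, beq_iff_eq, decide_eq_true_eq,
    isFrac_iff]
  constructor
  · rintro ⟨i, γ, rfl, h⟩
    obtain ⟨x, v, hmem, hle, hlen⟩ := hp i γ h
    obtain ⟨hx, -, hv, -⟩ := hS i hmem
    obtain ⟨r, hr, hrF⟩ := hφF i x v hx hv.1
    refine ⟨encTuple [encVec x, encVec v], hlen, ?_⟩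
    simp only [entry_zero, entry_succ]
    refine ⟨trivial, ⟨γ, rfl⟩, ⟨i, x, v, rfl, hx, hv⟩, (hχS i x v hx hv).2 hmem, ?_⟩
    rw [hr, fracLE_encFrac, hrF]
    exact hle
  · rintro ⟨c, -, hs, ⟨γ, hγ⟩, ⟨i, x, v, hsol, hx, hv⟩, hmem, hle⟩
    rw [hsol] at hmem hle
    have hi := encTuple_injective hsol
    simp only [List.cons.injEq, and_true] at hi
    rw [hi.1, hγ] at hs
    obtain ⟨r, hr, hrF⟩ := hφF i x v hx hv.1
    rw [hr, hγ, fracLE_encFrac, hrF] at hle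
    exact ⟨i, γ, hs, _, (hχS i x v hx hv).1 hmem, hle⟩

/-- The negatives of the upper-level constraint functions, as a family of lower-level objectives;
the parameter is the index of the constraint in unary. -/
theorem exists_objectiveFamily {δ : Word → ℝ} (hP : P.PolyPresented δ) :
    ∃ h : P.ObjectiveFamily,
      (∀ i x w, h.dom i x w ↔ x ∈ P.X i ∧ ∃ k : Fin (P.mu i), w = unaryEncodeNat k) ∧
      ∀ i x (k : Fin (P.mu i)) y, h.fn i x (unaryEncodeNat k) y = -P.G i k x y := by
  classical
  obtain ⟨φ, hφ, hφG⟩ := hP.G_computable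
  have hφ : PolyComp 0 φ := .of_dirty hφ
  have hmu : PolyComp 0 fun i => unaryEncodeNat (P.mu i) := .of_dirty hP.mu_computable
  have hX : PolyComp 0 (fun w : Word => decide (w ∈ P.upperDomainLanguage)) :=
    .of_mem_PRel hP.X_decidable
  refine ⟨{
    dom := fun i x w => x ∈ P.X i ∧ ∃ k : Fin (P.mu i), w = unaryEncodeNat k
    fn := fun i x w y => if h : w.length < P.mu i then -P.G i ⟨w.length, h⟩ x y else 0
    dom_subset := fun i x w h => h.1
    dom_decidable := ?_
    fn_computable := ?_ }, fun i x w => Iff.rfl, fun i x k y => ?_⟩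
  · have htuple : PolyComp 0 (fun s : Word => encTuple [entry 0 s, entry 1 s, entry 2 s]) := by
      simp only [encTuple_cons, encTuple_nil]; fun_prop
    have htuple' : PolyComp 0 (fun s : Word => encTuple [entry 0 s, entry 1 s]) := by
      simp only [encTuple_cons, encTuple_nil]; fun_prop
    have hk : PolyComp 0 (fun t : Word × Word => !(t.1 == t.2)) :=
      (PolyComp.beq (by fun_prop) (by fun_prop)).bnot
    refine PolyComp.mem_PRel (((PolyComp.beq .id htuple).band ((hX.comp htuple').band
      (PolyComp.bnot (PolyComp.forall_lt (hmu.comp (.entry 0 .id)) (.entry 2 .id) hk)))))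
      fun s => ?_
    simp only [Bool.and_eq_true, beq_iff_eq, decide_eq_true_eq, Bool.not_eq_true',
      length_unaryEncodeNat, decide_eq_false_iff_not, beq_eq_false_iff_ne, not_forall, ne_eq,
      not_not, exists_prop]
    constructor
    · rintro ⟨i, x, w, rfl, hx, k, rfl⟩
      simp only [entry_zero, entry_succ]
      exact ⟨trivial, mem_upperDomainLanguage.2 hx, k, k.2, rfl⟩
    · rintro ⟨hs, ⟨i, x, hx, hxX⟩, k, hk, hw⟩
      have hi := encTuple_injective hx
      simp only [List.cons.injEq, and_true] at hi
      rw [hi.1] at hk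
      rw [hi.1, hi.2] at hs
      exact ⟨i, x, _, hs, hxX, ⟨k, hk⟩, hw.symm⟩
  · refine ⟨fun s => fracNeg (φ (encTuple [entry 0 s, entry 2 s, entry 1 s, entry 3 s])),
      PolyComp.polyTimeRel (PolyComp.fracNeg (hφ.comp ?_)), ?_⟩
    · simp only [encTuple_cons, encTuple_nil]; fun_prop
    · rintro i x w y ⟨hx, k, rfl⟩ hy
      obtain ⟨r, hr, hrG⟩ := hφG i k x y hx hy
      refine ⟨r.neg, ?_, ?_⟩
      · simp only [entry_zero, entry_succ]
        rw [hr, fracNeg_encFrac]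
      · simp [length_unaryEncodeNat, Frac.val_neg, hrG]
  · simp [length_unaryEncodeNat]

theorem forall_unary_iff {n : ℕ} (p : Word → Prop) {q : Fin n → Prop}
    (h : ∀ k : Fin n, p (unaryEncodeNat k) ↔ q k) :
    (∀ k < (unaryEncodeNat n).length, p (unaryEncodeNat k)) ↔ ∀ k, q k := by
  rw [length_unaryEncodeNat]
  exact ⟨fun H k => (h k).1 (H k k.2), fun H k hk => (h ⟨k, hk⟩).2 (H ⟨k, hk⟩)⟩

open Classical in
/-- With an oracle for the lower-level problem, canonical feasibility is decidable in polynomial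
time. -/
theorem exists_canonicalFeasible_test {A : Language Bool} {δ : Word → ℝ}
    (hP : P.PolyPresented δ) (hlow : P.LowerGap)
    (hA : ∀ w, true :: w ∈ A ↔ w ∈ P.lowerDecision) :
    ∃ χ : Word → Bool, PolyComp A χ ∧
      ∀ (i : Word) (x : FracVec (P.nx i)) (v : FracVec (P.ny i)), x.val ∈ P.X i →
        v.val ∈ P.lowerFeasible i x.val →
        (χ (encTuple [i, encVec x, encVec v]) = true ↔
          (x.val, v.val) ∈ P.canonicalFeasible i) := by
  obtain ⟨p, hp⟩ := hlow
  obtain ⟨φf, hφf, hf⟩ := hP.f_computable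
  obtain ⟨φG, hφG, hG⟩ := hP.G_computable
  have hφf : PolyComp A φf := (PolyComp.of_dirty hφf).mono_zero
  have hφG : PolyComp A φG := (PolyComp.of_dirty hφG).mono_zero
  have hmu : PolyComp A fun i => unaryEncodeNat (P.mu i) :=
    (PolyComp.of_dirty hP.mu_computable).mono_zero
  -- By `LowerGap`, `v` is optimal iff the value `f x v - 2 ^ (-p N)` is not attained.
  let query (s : Word) : Word := true :: encTuple [entry 0 s, entry 1 s,
    fracAdd (φf s) (fracNegPow (List.replicate (p.eval s.length) false))]
  have hquery : PolyComp A query := by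
    have := PolyComp.replicate_eval (O := A) p
    simp only [query, encTuple_cons, encTuple_nil]
    fun_prop
  let test (t : Word × Word) : Bool :=
    fracNonpos (φG (encTuple [entry 0 t.2, t.1, entry 1 t.2, entry 2 t.2]))
  have htest : PolyComp A test := by
    refine PolyComp.fracNonpos (hφG.comp ?_)
    simp only [encTuple_cons, encTuple_nil]
    fun_prop
  refine ⟨_, (PolyComp.bnot (PolyComp.mem_oracle.comp hquery)).band
    (PolyComp.forall_lt (hmu.comp (.entry 0 .id)) .id htest), fun i x v hx hv => ?_⟩
  obtain ⟨r, hr, hrf⟩ := hf i x v hx hv.1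
  have hopt : ¬ AttainsBound (P.lowerFeasible i x.val) (P.f i x.val) (P.f i x.val v.val +
      -(1 / 2) ^ p.eval (encTuple [i, encVec x, encVec v]).length) ↔
      v.val ∈ P.lowerOptimal i x.val := by
    constructor
    · intro h
      refine ⟨hv, fun y hy => ?_⟩
      by_contra! hlt
      exact h (hp i x v hx hv ⟨y, hy, hlt⟩)
    · rintro h ⟨y, hy, hle⟩
      have h1 := h.2 y hy
      have h2 : (0 : ℝ) < (1 / 2) ^ p.eval (encTuple [i, encVec x, encVec v]).length := by
        positivity
      linarith
  simp only [Bool.and_eq_true, Bool.not_eq_true', decide_eq_false_iff_not, decide_eq_true_eq,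
    query, test, entry_zero, entry_succ, hA]
  rw [forall_unary_iff
    (fun w => fracNonpos (φG (encTuple [i, w, encVec x, encVec v])) = true)
    (q := fun k => P.G i k x.val v.val ≤ 0) fun k => by
    obtain ⟨r, hr, hrG⟩ := hG i k x v hx hv.1
    rw [hr, fracNonpos_encFrac, hrG]]
  rw [hr, fracNegPow_replicate, fracAdd_encFrac, mem_lowerDecision, Frac.val_add, hrf,
    Frac.val_neg_one_two_pow, and_iff_right hx, hopt]
  exact ⟨fun h => ⟨hx, h.2, h.1⟩, fun h => ⟨h.2.2, h.2.1⟩⟩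

open Classical in
/-- With an additional oracle for the epigraph form of the lower-level problem, the robustness
condition is decidable in polynomial time. -/
theorem exists_robustFeasible_test {A : Language Bool} {δ : Word → ℝ}
    (hP : P.PolyPresented δ) (hlow : P.LowerGap) (hadv : P.AdversarialGap δ)
    (hA : ∀ w, true :: w ∈ A ↔ w ∈ P.lowerDecision) {h : P.ObjectiveFamily}
    (hdom : ∀ i x w, h.dom i x w ↔ x ∈ P.X i ∧ ∃ k : Fin (P.mu i), w = unaryEncodeNat k)
    (hfn : ∀ i x (k : Fin (P.mu i)) y, h.fn i x (unaryEncodeNat k) y = -P.G i k x y)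
    (hA' : ∀ w, false :: w ∈ A ↔ w ∈ P.starDecision h) :
    ∃ χ : Word → Bool, PolyComp A χ ∧
      ∀ (i : Word) (x : FracVec (P.nx i)) (v : FracVec (P.ny i)), x.val ∈ P.X i →
        v.val ∈ P.lowerFeasible i x.val →
        (χ (encTuple [i, encVec x, encVec v]) = true ↔
          (x.val, v.val) ∈ P.robustFeasible δ i) := by
  obtain ⟨χ, hχ, hχS⟩ := exists_canonicalFeasible_test hP hlow hA
  obtain ⟨p, hp⟩ := hadv
  obtain ⟨φf, hφf, hf⟩ := hP.f_computable
  obtain ⟨φδ, hφδ, hδ⟩ := hP.tol_computable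
  have hφf : PolyComp A φf := (PolyComp.of_dirty hφf).mono_zero
  have hφδ : PolyComp A φδ := (PolyComp.of_dirty hφδ).mono_zero
  have hmu : PolyComp A fun i => unaryEncodeNat (P.mu i) :=
    (PolyComp.of_dirty hP.mu_computable).mono_zero
  -- The linear constraint `0 ⬝ y + 1 * u ≤ f x v + δ` restricts `y` to the near-optimal set.
  let query (t : Word × Word) : Word := false :: encTuple [entry 0 t.2, entry 1 t.2, t.1,
    zeroLike (entry 2 t.2), encFrac (1, 1), fracAdd (φf t.2) (φδ (entry 0 t.2)),
    fracNegPow (List.replicate (p.eval t.2.length) false)]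
  have hquery : PolyComp A query := by
    have := (PolyComp.replicate_eval (O := A) p).comp (PolyComp.snd (α := Word))
    simp only [query, encTuple_cons, encTuple_nil]
    fun_prop
  refine ⟨_, hχ.band (PolyComp.forall_lt (hmu.comp (.entry 0 .id)) .id
    (PolyComp.bnot (PolyComp.mem_oracle.comp hquery))), fun i x v hx hv => ?_⟩
  obtain ⟨r, hr, hrf⟩ := hf i x v hx hv.1
  obtain ⟨d, hd, hdδ⟩ := hδ i
  rw [Bool.and_eq_true, hχS i x v hx hv]
  refine and_congr_right fun hcan => ?_
  simp only [Bool.not_eq_true', decide_eq_false_iff_not, decide_eq_true_eq, query, entry_zero,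
    entry_succ, hA']
  refine forall_unary_iff (fun w => encTuple [i, encVec x, w, zeroLike (encVec v), encFrac (1, 1),
    fracAdd (φf _) (φδ i), fracNegPow _] ∉ P.starDecision h) fun k => ?_
  rw [zeroLike_encVec, hr, hd, fracAdd_encFrac, fracNegPow_replicate, mem_starDecision,
    Frac.val_add, hrf, hdδ, Frac.val_neg_one_two_pow, and_iff_right ((hdom _ _ _).2 ⟨hx, k, rfl⟩)]
  have hzero : FracVec.val (fun _ : Fin (P.ny i) => ((0, 1) : Frac)) = 0 := by
    funext j; simp [FracVec.val, Frac.val]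
  have hone : Frac.val (1, 1) = 1 := by simp [Frac.val]
  rw [hzero, hone]
  constructor
  · intro hno z hz
    by_contra! hpos
    obtain ⟨z, hz, hzG⟩ := hp i x v k hx hcan.2.2 ⟨z, hz, hpos⟩
    refine hno ⟨(z, P.f i x.val z), ⟨hz.1, le_rfl, ?_⟩, ?_⟩
    · simpa using hz.2
    · beta_reduce; rw [hfn]; exact neg_le_neg hzG
  · rintro hrob ⟨⟨z, u⟩, ⟨hz, hzu, hu⟩, hzG⟩
    have h1 := hrob z ⟨hz, hzu.trans (by simpa using hu)⟩
    beta_reduce at hzG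
    rw [hfn] at hzG
    have h2 : (0 : ℝ) < (1 / 2) ^ p.eval (encTuple [i, encVec x, encVec v]).length := by
      positivity
    linarith

end BilevelProblem

open BilevelProblem in
theorem theorem1 (P : BilevelProblem) (δ : Word → ℝ)
    (hP : P.PolyPresented δ) (hlow : P.LowerGap) (hadv : P.AdversarialGap δ)
    (hH : ∃ H : ∀ i, Set ((Fin (P.ny i) → ℝ) → ℝ),
      P.LowerInStar (SigmaP 1) H ∧
      ∀ (i : Word) (k : Fin (P.mu i)), ∀ x ∈ P.X i, (fun y => -P.G i k x y) ∈ H i) :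
    (P.SmallSolutions (P.robustFeasible δ) → P.upperDecision (P.robustFeasible δ) ∈ SigmaP 2) ∧
    (P.SmallSolutions P.canonicalFeasible → P.upperDecision P.canonicalFeasible ∈ SigmaP 2) := by
  obtain ⟨H, ⟨hL₁, hL₂⟩, hGH⟩ := hH
  obtain ⟨h, hdom, hfn⟩ := exists_objectiveFamily hP
  have hL₂ : P.starDecision h ∈ SigmaP 1 := hL₂ h fun i x w hw => by
    obtain ⟨hx, k, rfl⟩ := (hdom i x w).1 hw
    rw [funext (hfn i x k)]
    exact hGH i k x hx
  have hA : taggedUnion P.lowerDecision (P.starDecision h) ∈ SigmaP 1 :=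
    taggedUnion_mem_NPRel hL₁ hL₂
  have hA₁ (w : Word) : true :: w ∈ taggedUnion P.lowerDecision (P.starDecision h) ↔ _ :=
    true_cons_mem_taggedUnion
  have hA₂ (w : Word) : false :: w ∈ taggedUnion P.lowerDecision (P.starDecision h) ↔ _ :=
    false_cons_mem_taggedUnion
  constructor
  · intro hsmall
    obtain ⟨χ, hχ, hχS⟩ := exists_robustFeasible_test hP hlow hadv hA₁ hdom hfn hA₂
    exact ⟨_, hA, upperDecision_mem_NPRel hP hχ (fun i q hq => hq.1) hχS hsmall⟩
  · intro hsmall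
    obtain ⟨χ, hχ, hχS⟩ := exists_canonicalFeasible_test hP hlow hA₁
    exact ⟨_, hA, upperDecision_mem_NPRel hP hχ (fun i q hq => hq) hχS hsmall⟩
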